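/- Let $G=(V,E)$ be a finite simple $D$-regular graph with $D\ge 1$ and $n=|V|$, and place one $d$-dimensional quantum system (qudit) $Q_v\cong\mathbb{C}^d$ at every vertex $v\in V$. Let $\rho$ be any state (positive semidefinite operator of unit trace) on $\bigotimes_{v\in V}Q_v\cong(\mathbb{C}^d)^{\otimes n}$. Then there exists a globally separable state $\sigma$ on $\bigotimes_{v\in V}Q_v$, i.e. a state of the form $\sigma=\sum_z p_z\bigotimes_{v\in V}\sigma_{z}^{Q_v}$ with $(p_z)_z$ a finite probability distribution and each $\sigma_z^{Q_v}$ a state on $Q_v$, such that $$\mathop{\mathbb{E}}_{(i,j)\in E}\left\|\rho^{Q_iQ_j}-\sigma^{Q_iQ_j}\right\|_1\;\le\;12\left(\frac{d^2\ln d}{D}\right)^{1/3}.$$ Here $\mathbb{E}_{(i,j)\in E}$ is the average over a uniformly random edge of $G$, $\rho^{Q_iQ_j}$ is the reduced state of $\rho$ on $Q_iQ_j$ (the partial trace over all other qudits), and $\|X\|_1=\operatorname{tr}\sqrt{X^\dagger X}$ is the trace norm (without a factor $1/2$). -/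

import Mathlib

namespace QuditState

open Matrix

noncomputable section

section Basics

open scoped MatrixOrder ComplexOrder

/-- A density matrix: positive semidefinite with unit trace. -/
def IsState {ι : Type*} [Fintype ι] (ρ : Matrix ι ι ℂ) : Prop :=
  ρ.PosSemidef ∧ ρ.trace = 1

/-- The trace norm `tr √(Xᴴ X)`; the matrix `√(Xᴴ X)` is positive semidefinite, so its trace
is a nonnegative real number. -/
def traceNorm {ι : Type*} [Fintype ι] [DecidableEq ι] (X : Matrix ι ι ℂ) : ℝ :=
  (CFC.sqrt (Xᴴ * X)).trace.re

end Basics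

/-- Operators on `⨂_{v ∈ V} ℂ^d`, as matrices in the product basis, which is indexed by the
functions `V → Fin d`. -/
abbrev Op (V : Type*) (d : ℕ) : Type _ :=
  Matrix (V → Fin d) (V → Fin d) ℂ

/-- The tensor product `⨂_v τ v` of single-site operators. -/
def tensor {V : Type*} [Fintype V] {d : ℕ} (τ : V → Matrix (Fin d) (Fin d) ℂ) : Op V d :=
  Matrix.of fun x y => ∏ v, τ v (x v) (y v)

/-- The marginal on the sites in `S`: the partial trace over all the sites outside `S`. -/
def marginal {V : Type*} [Fintype V] [DecidableEq V] {d : ℕ} (S : Finset V) (ρ : Op V d) :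
    Op {v // v ∈ S} d :=
  Matrix.of fun x y => ∑ z : {v // v ∉ S} → Fin d,
    ρ ((Equiv.piEquivPiSubtypeProd (fun v => v ∈ S) (fun _ => Fin d)).symm (x, z))
      ((Equiv.piEquivPiSubtypeProd (fun v => v ∈ S) (fun _ => Fin d)).symm (y, z))

/-- `σ` is globally separable: a convex combination of product states. -/
def IsGloballySeparable {V : Type*} [Fintype V] {d : ℕ} (σ : Op V d) : Prop :=
  ∃ (m : ℕ) (p : Fin m → ℝ) (τ : Fin m → V → Matrix (Fin d) (Fin d) ℂ),
    (∀ z, 0 ≤ p z) ∧ ∑ z, p z = 1 ∧ (∀ z v, IsState (τ z v)) ∧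
      σ = ∑ z, (p z : ℂ) • tensor (τ z)

/-- The average of `f` over the (unordered) edges of `G`. -/
def edgeAverage {V : Type*} [Fintype V] [DecidableEq V] (G : SimpleGraph V)
    [DecidableRel G.Adj] (f : Sym2 V → ℝ) : ℝ :=
  (∑ e ∈ G.edgeFinset, f e) / (G.edgeFinset.card : ℝ)

end

end QuditState

/-! Conditioning on local measurement outcomes destroys correlations cheaply. Fix an informationally
complete measurement, apply it to every site of a set `C`, and prepare at each unmeasured site its
conditional state given the outcomes `z`. The resulting mixture of product states is
`measurePrepare`, the separable state of the theorem. For `i, j ∉ C`, measuring `j` as well lowers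
the entropy of `i` given the outcomes. By a Pinsker type bound (`deviation_le`) this decrease
controls how far the state of `i` moves when the outcome at `j` is revealed. A dual frame of trace
at most `2d` rebuilds the two-site marginal from these conditional states, so the error on `{i, j}`
is at most `2d` times that deviation (`traceNorm_marginal_sub_le`). The set `C` minimises the total
conditional entropy of the unmeasured sites plus a price `l` per measured site
(`exists_conditioning_set`). Minimality makes `C` small, and no further site `j` can lower the
entropies of the other sites by more than `l` in total. In `edgeAverage_le`, edges meeting `C` cost
at most 2 each and the remaining edges are paid for by entropy decreases. With `n` sites, `x ^ 3 = d
^ 2 * log d / D` and `l = log d / x`, one gets `|C| ≤ n x` and total error `8 x`. All Pinsker type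
bounds are kept in the linear form `ε * t - ε ^ 2 ≤ entropy`, so they can be summed directly without
Jensen's inequality; `ε` is fixed only at the end. -/

namespace QuditState

open Matrix
open scoped MatrixOrder ComplexOrder

/-! ### Traces and normalisation of positive semidefinite matrices. -/

section Trace

variable {ι : Type*} [Fintype ι]

theorem trace_re_nonneg {A : Matrix ι ι ℂ} (hA : A.PosSemidef) : 0 ≤ A.trace.re :=
  (Complex.le_def.mp hA.trace_nonneg).1

theorem trace_conjTranspose_mul_self_nonneg (A : Matrix ι ι ℂ) : 0 ≤ (Aᴴ * A).trace.re :=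
  trace_re_nonneg (posSemidef_conjTranspose_mul_self A)

theorem trace_eq_re {R : Matrix ι ι ℂ} (hR : R.PosSemidef) : R.trace = (R.trace.re : ℂ) :=
  (Complex.eq_re_of_ofReal_le (r := 0) (by simpa using hR.trace_nonneg))

theorem IsState.nonempty {A : Matrix ι ι ℂ} (hA : IsState A) : Nonempty ι := by
  by_contra h
  rw [not_nonempty_iff] at h
  have := hA.2
  simp [Matrix.trace] at this

theorem isState_normalize {R : Matrix ι ι ℂ} (hR : R.PosSemidef) (h : R.trace.re ≠ 0) :
    IsState ((R.trace.re⁻¹ : ℂ) • R) := by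
  constructor
  · refine hR.smul ?_
    rw [← Complex.ofReal_inv]
    exact_mod_cast inv_nonneg.mpr (trace_re_nonneg hR)
  · rw [trace_smul, smul_eq_mul, trace_eq_re hR, Complex.ofReal_re]
    exact inv_mul_cancel₀ (by exact_mod_cast h)

end Trace

/-! ### Calculus of matrices in spectral form. -/

section SpectralForm

variable {ι : Type*} [Fintype ι] [DecidableEq ι]

/-- The operator `U diag(f) Uᴴ`. -/
noncomputable def spec (U : Matrix ι ι ℂ) (f : ι → ℝ) : Matrix ι ι ℂ :=
  U * diagonal (fun i => (f i : ℂ)) * Uᴴ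

theorem isHermitian_spec (U : Matrix ι ι ℂ) (f : ι → ℝ) : (spec U f).IsHermitian := by
  have h : (diagonal (fun i => (f i : ℂ))).IsHermitian := by
    rw [IsHermitian, diagonal_conjTranspose]
    congr 1
    ext i
    simp
  exact isHermitian_mul_mul_conjTranspose U h

theorem posSemidef_spec (U : Matrix ι ι ℂ) {f : ι → ℝ} (hf : ∀ i, 0 ≤ f i) :
    (spec U f).PosSemidef := by
  refine PosSemidef.mul_mul_conjTranspose_same (PosSemidef.diagonal fun i => ?_) U
  simpa using hf i

theorem spec_mul_spec {U : Matrix ι ι ℂ} (hU : Uᴴ * U = 1) (f g : ι → ℝ) :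
    spec U f * spec U g = spec U (fun i => f i * g i) := by
  calc spec U f * spec U g
      = U * diagonal (fun i => (f i : ℂ)) * (Uᴴ * U) * diagonal (fun i => (g i : ℂ)) * Uᴴ := by
        simp only [spec, Matrix.mul_assoc]
    _ = _ := by
        rw [hU, Matrix.mul_one, Matrix.mul_assoc U, diagonal_mul_diagonal, spec]
        simp

theorem spec_sub (U : Matrix ι ι ℂ) (f g : ι → ℝ) :
    spec U (fun i => f i - g i) = spec U f - spec U g := by
  simp only [spec, ← Matrix.sub_mul, ← Matrix.mul_sub]
  congr 2
  rw [diagonal_sub]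
  simp

theorem trace_spec {U : Matrix ι ι ℂ} (hU : Uᴴ * U = 1) (f : ι → ℝ) :
    (spec U f).trace = ((∑ i, f i : ℝ) : ℂ) := by
  rw [spec, Matrix.trace_mul_comm, ← Matrix.mul_assoc, hU, Matrix.one_mul, trace_diagonal]
  simp

theorem spec_one {U : Matrix ι ι ℂ} (hU : U * Uᴴ = 1) : spec U (fun _ => 1) = 1 := by
  simp [spec, hU]

theorem exists_spec {A : Matrix ι ι ℂ} (hA : A.IsHermitian) :
    ∃ U : Matrix ι ι ℂ, Uᴴ * U = 1 ∧ U * Uᴴ = 1 ∧ A = spec U hA.eigenvalues := by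
  refine ⟨hA.eigenvectorUnitary, ?_, ?_, ?_⟩
  · exact Unitary.star_mul_self_of_mem hA.eigenvectorUnitary.2
  · exact Unitary.mul_star_self_of_mem hA.eigenvectorUnitary.2
  · conv_lhs => rw [hA.spectral_theorem, Unitary.conjStarAlgAut_apply]
    rfl

/-- The squared overlaps of the columns of `U` and `W` act as classical weights; this is how
inequalities for two noncommuting matrices reduce to scalar ones. -/
theorem trace_spec_mul_spec (U W : Matrix ι ι ℂ) (f g : ι → ℝ) :
    (spec U f * spec W g).trace.re =
      ∑ i, ∑ j, f i * g j * Complex.normSq ((Uᴴ * W) i j) := by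
  have h : (spec U f * spec W g).trace =
      (diagonal (fun i => (f i : ℂ)) * (Uᴴ * W) *
        (diagonal (fun i => (g i : ℂ)) * (Uᴴ * W)ᴴ)).trace := by
    rw [spec, spec, Matrix.mul_assoc, Matrix.mul_assoc, Matrix.trace_mul_comm]
    simp only [conjTranspose_mul, conjTranspose_conjTranspose, Matrix.mul_assoc]
  rw [h, Matrix.trace, Complex.re_sum]
  refine Finset.sum_congr rfl fun i _ => ?_
  rw [diag_apply, Matrix.mul_apply, Complex.re_sum]
  refine Finset.sum_congr rfl fun j _ => ?_
  rw [diagonal_mul, diagonal_mul, conjTranspose_apply, ← Complex.ofReal_re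
    (f i * g j * Complex.normSq ((Uᴴ * W) i j))]
  congr 1
  push_cast
  rw [← Complex.mul_conj, Complex.star_def]
  ring

end SpectralForm

/-! ### The trace norm of Hermitian matrices. -/

section TraceNorm

variable {ι : Type*} [Fintype ι] [DecidableEq ι]

theorem traceNorm_spec {U : Matrix ι ι ℂ} (hU : Uᴴ * U = 1) (f : ι → ℝ) :
    traceNorm (spec U f) = ∑ i, |f i| := by
  have h : CFC.sqrt ((spec U f)ᴴ * spec U f) = spec U (fun i => |f i|) := by
    refine CFC.sqrt_unique ?_ (nonneg_iff_posSemidef.mpr (posSemidef_spec U fun i => abs_nonneg _))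
    rw [(isHermitian_spec U f).eq, spec_mul_spec hU, spec_mul_spec hU]
    simp
  rw [traceNorm, h, trace_spec hU, Complex.ofReal_re]

theorem exists_posSemidef_sub {X : Matrix ι ι ℂ} (hX : X.IsHermitian) :
    ∃ P N : Matrix ι ι ℂ, P.PosSemidef ∧ N.PosSemidef ∧ X = P - N ∧
      traceNorm X = P.trace.re + N.trace.re := by
  obtain ⟨U, hU, -, hXU⟩ := exists_spec hX
  refine ⟨spec U (fun i => (hX.eigenvalues i)⁺), spec U (fun i => (hX.eigenvalues i)⁻),
    posSemidef_spec U fun i => posPart_nonneg _, posSemidef_spec U fun i => negPart_nonneg _, ?_, ?_⟩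
  · rw [← spec_sub]
    simpa only [posPart_sub_negPart] using hXU
  · conv_lhs => rw [hXU]
    rw [traceNorm_spec hU, trace_spec hU, trace_spec hU, Complex.ofReal_re, Complex.ofReal_re,
      ← Finset.sum_add_distrib]
    exact Finset.sum_congr rfl fun i _ => (posPart_add_negPart _).symm

/-- Zero eigenvalues receive the sign `+1`, so that the sign matrix is an exact involution even when
`X` is singular. -/
theorem exists_sign {X : Matrix ι ι ℂ} (hX : X.IsHermitian) :
    ∃ S : Matrix ι ι ℂ, S.IsHermitian ∧ S * S = 1 ∧ traceNorm X = (S * X).trace.re := by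
  obtain ⟨U, hU, hU', hXU⟩ := exists_spec hX
  refine ⟨spec U (fun i => if 0 ≤ hX.eigenvalues i then 1 else -1), isHermitian_spec _ _, ?_, ?_⟩
  · rw [spec_mul_spec hU, ← spec_one hU']
    congr 1
    ext i
    split_ifs <;> simp
  · have e : spec U (fun i => if 0 ≤ hX.eigenvalues i then 1 else -1) * X =
        spec U (fun i => (if 0 ≤ hX.eigenvalues i then 1 else -1) * hX.eigenvalues i) := by
      rw [← spec_mul_spec hU]
      exact congrArg _ hXU
    rw [e, trace_spec hU, Complex.ofReal_re]
    conv_lhs => rw [hXU]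
    rw [traceNorm_spec hU]
    refine Finset.sum_congr rfl fun i _ => ?_
    split_ifs with h
    · rw [abs_of_nonneg h, one_mul]
    · rw [abs_of_neg (not_le.mp h), neg_one_mul]

/-- A Hermitian involution has expectation at most one. -/
theorem trace_involution_mul_le {S P : Matrix ι ι ℂ} (hS : S.IsHermitian) (hSS : S * S = 1)
    (hP : P.PosSemidef) : (S * P).trace.re ≤ P.trace.re := by
  -- Since `(1 - S) ^ 2 = 2 (1 - S)`, this conjugate of `P` has trace `2 (tr P - tr S P)`.
  have h := trace_re_nonneg (hP.mul_mul_conjTranspose_same (1 - S))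
  have e : ((1 - S) * P * (1 - S)ᴴ).trace = 2 * (P.trace - (S * P).trace) := by
    rw [Matrix.trace_mul_comm, ← Matrix.mul_assoc, conjTranspose_sub, hS.eq, conjTranspose_one]
    have : (1 - S) * (1 - S) = (2 : ℂ) • (1 - S) := by
      rw [Matrix.sub_mul, Matrix.mul_sub S, hSS, two_smul, Matrix.one_mul, Matrix.mul_one]
      abel
    rw [this, smul_mul, trace_smul, Matrix.sub_mul, trace_sub, Matrix.one_mul, smul_eq_mul]
  rw [e] at h
  simp at h
  exact h

theorem traceNorm_sub_le {P N : Matrix ι ι ℂ} (hP : P.PosSemidef) (hN : N.PosSemidef) :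
    traceNorm (P - N) ≤ P.trace.re + N.trace.re := by
  obtain ⟨S, hS, hSS, h⟩ := exists_sign (hP.isHermitian.sub hN.isHermitian)
  have h1 := trace_involution_mul_le hS hSS hP
  have h2 := trace_involution_mul_le hS.neg (by simpa using hSS) hN
  rw [h, Matrix.mul_sub, trace_sub, Complex.sub_re]
  rw [Matrix.neg_mul, trace_neg, Complex.neg_re] at h2
  linarith

theorem traceNorm_zero : traceNorm (0 : Matrix ι ι ℂ) = 0 := by
  simp [traceNorm]

theorem traceNorm_sub_le_two {P N : Matrix ι ι ℂ} (hP : IsState P) (hN : IsState N) :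
    traceNorm (P - N) ≤ 2 := by
  refine (traceNorm_sub_le hP.1 hN.1).trans ?_
  rw [hP.2, hN.2]
  norm_num

theorem traceNorm_smul_le {X : Matrix ι ι ℂ} (hX : X.IsHermitian) {c : ℝ} (hc : 0 ≤ c) :
    traceNorm ((c : ℂ) • X) ≤ c * traceNorm X := by
  obtain ⟨P, N, hP, hN, h, h'⟩ := exists_posSemidef_sub hX
  have hc' : (0 : ℂ) ≤ c := by exact_mod_cast hc
  have := traceNorm_sub_le (hP.smul hc') (hN.smul hc')
  rw [← smul_sub, ← h] at this
  refine this.trans_eq ?_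
  rw [h', trace_smul, trace_smul]
  simp
  ring

end TraceNorm

/-! ### Von Neumann entropy and Pinsker type bounds. -/

section Entropy

variable {ι : Type*} [Fintype ι] [DecidableEq ι]

open Classical in
/-- The von Neumann entropy of a Hermitian matrix. -/
noncomputable def entropy (A : Matrix ι ι ℂ) : ℝ :=
  if h : A.IsHermitian then ∑ i, Real.negMulLog (h.eigenvalues i) else 0

theorem entropy_eq {A : Matrix ι ι ℂ} (h : A.IsHermitian) :
    entropy A = ∑ i, Real.negMulLog (h.eigenvalues i) := dif_pos h

theorem IsState.sum_eigenvalues {A : Matrix ι ι ℂ} (hA : IsState A) :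
    ∑ i, hA.1.isHermitian.eigenvalues i = 1 := by
  have h := hA.1.isHermitian.trace_eq_sum_eigenvalues
  have h' := congrArg Complex.re (hA.2.symm.trans h)
  rw [Complex.re_sum, Complex.one_re] at h'
  exact h'.symm

theorem entropy_nonneg {A : Matrix ι ι ℂ} (hA : IsState A) : 0 ≤ entropy A := by
  rw [entropy_eq hA.1.isHermitian]
  refine Finset.sum_nonneg fun i _ => Real.negMulLog_nonneg (hA.1.eigenvalues_nonneg i) ?_
  rw [← hA.sum_eigenvalues]
  exact Finset.single_le_sum (fun j _ => hA.1.eigenvalues_nonneg j) (Finset.mem_univ i)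

theorem entropy_le_log_card {A : Matrix ι ι ℂ} (hA : IsState A) :
    entropy A ≤ Real.log (Fintype.card ι) := by
  have := hA.nonempty
  have hn : (0 : ℝ) < Fintype.card ι := by exact_mod_cast Fintype.card_pos
  -- Gibbs' inequality against the uniform distribution, term by term; the first two terms on the
  -- right cancel after summation.
  have key : ∀ x : ℝ, 0 ≤ x →
      Real.negMulLog x ≤ (Fintype.card ι : ℝ)⁻¹ - x + x * Real.log (Fintype.card ι) := by
    intro x hx
    rcases hx.eq_or_lt with rfl | hx
    · simp
    · have h1 := Real.add_one_le_exp (Real.log ((Fintype.card ι : ℝ)⁻¹ / x))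
      rw [Real.exp_log (by positivity), Real.log_div (by positivity) hx.ne', Real.log_inv] at h1
      have h2 := mul_le_mul_of_nonneg_left h1 hx.le
      rw [mul_div_cancel₀ _ hx.ne'] at h2
      rw [Real.negMulLog]
      linarith
  rw [entropy_eq hA.1.isHermitian]
  refine (Finset.sum_le_sum fun i _ => key _ (hA.1.eigenvalues_nonneg i)).trans_eq ?_
  rw [Finset.sum_add_distrib, Finset.sum_sub_distrib, ← Finset.sum_mul, hA.sum_eigenvalues]
  simp

/-- This is `log t ≤ t - 1` at `t = √b / √a`. It is the scalar source of the bound of relative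
entropy by the Hellinger-like quantity `2 - 2 tr √A √B`. -/
theorem mul_log_sub_log_ge {a b : ℝ} (ha : 0 ≤ a) (hb : 0 ≤ b) (h : b = 0 → a = 0) :
    2 * (a - √a * √b) ≤ a * (Real.log a - Real.log b) := by
  rcases ha.eq_or_lt with rfl | ha
  · simp
  have hb : 0 < b := hb.lt_of_ne fun hb => ha.ne' (h hb.symm)
  have h1 := Real.add_one_le_exp (Real.log (√b / √a))
  rw [Real.exp_log (by positivity), Real.log_div (by positivity) (by positivity),
    Real.log_sqrt hb.le, Real.log_sqrt ha.le] at h1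
  have h2 := mul_le_mul_of_nonneg_left h1 ha.le
  have h3 : a * (√b / √a) = √a * √b := by
    have : √a ≠ 0 := by positivity
    field_simp
    rw [Real.sq_sqrt ha.le]
  rw [h3] at h2
  linarith

/-- A Powers–Størmer type bound. -/
theorem traceNorm_sub_le_trace_sq {s t : Matrix ι ι ℂ} (hs : s.IsHermitian) (ht : t.IsHermitian)
    (hs1 : (s * s).trace.re = 1) (ht1 : (t * t).trace.re = 1) (ε : ℝ) :
    ε * traceNorm (s * s - t * t) - ε ^ 2 ≤ 2 - 2 * (s * t).trace.re := by
  have hX : (s * s - t * t).IsHermitian := by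
    refine IsHermitian.sub ?_ ?_
    · simpa [hs.eq] using isHermitian_conjTranspose_mul_self s
    · simpa [ht.eq] using isHermitian_conjTranspose_mul_self t
  obtain ⟨S, hS, hSS, h⟩ := exists_sign hX
  have hF : (s - t)ᴴ = s - t := (hs.sub ht).eq
  have hG : (s + t)ᴴ = s + t := (hs.add ht).eq
  have hcomm : (t * s).trace = (s * t).trace := Matrix.trace_mul_comm _ _
  -- Cauchy–Schwarz in linearised form. As `s² - t²` is the symmetrised product of `s - t` and `s +
  -- t`, the cross term of this square is `ε` times the trace norm.
  have h1 := trace_conjTranspose_mul_self_nonneg ((s - t) - ((ε / 2 : ℝ) : ℂ) • ((s + t) * S))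
  have h2 := trace_conjTranspose_mul_self_nonneg (s - t)
  have e1 : ((s - t)ᴴ * (s - t)).trace.re = 2 - 2 * (s * t).trace.re := by
    rw [hF, Matrix.sub_mul, Matrix.mul_sub, Matrix.mul_sub]
    simp only [trace_sub, Complex.sub_re, hcomm, hs1, ht1]
    ring
  have e3 : ((s + t) * (s + t)).trace.re = 2 + 2 * (s * t).trace.re := by
    rw [Matrix.add_mul, Matrix.mul_add, Matrix.mul_add]
    simp only [trace_add, Complex.add_re, hcomm, hs1, ht1]
    ring
  have e4 : (((s + t) * S)ᴴ * ((s + t) * S)).trace = ((s + t) * (s + t)).trace := by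
    rw [conjTranspose_mul, hS.eq, hG, Matrix.mul_assoc, Matrix.trace_mul_comm]
    simp only [Matrix.mul_assoc, hSS, Matrix.mul_one]
  have e5 : ((s - t)ᴴ * ((s + t) * S)).trace + (((s + t) * S)ᴴ * (s - t)).trace =
      2 * (S * (s * s - t * t)).trace := by
    rw [conjTranspose_mul, hS.eq, hF, hG, ← Matrix.mul_assoc, Matrix.trace_mul_comm,
      Matrix.mul_assoc, ← trace_add, ← Matrix.mul_add]
    have : (s - t) * (s + t) + (s + t) * (s - t) = (2 : ℂ) • (s * s - t * t) := by
      rw [two_smul]; noncomm_ring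
    rw [this, Matrix.mul_smul, trace_smul, smul_eq_mul]
  have e2 : (((s - t) - ((ε / 2 : ℝ) : ℂ) • ((s + t) * S))ᴴ *
      ((s - t) - ((ε / 2 : ℝ) : ℂ) • ((s + t) * S))).trace.re =
      (2 - 2 * (s * t).trace.re) - ε * traceNorm (s * s - t * t) +
        ε ^ 2 / 4 * (2 + 2 * (s * t).trace.re) := by
    rw [h, ← e1, ← e3, ← e4]
    have e5' := congrArg Complex.re e5
    simp only [Complex.add_re, Complex.mul_re, Complex.re_ofNat, Complex.im_ofNat] at e5'
    rw [conjTranspose_sub, conjTranspose_smul, Matrix.sub_mul, Matrix.mul_sub (s - t)ᴴ,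
      Matrix.mul_sub (star _ • _)]
    simp only [trace_sub, Matrix.smul_mul, Matrix.mul_smul, trace_smul, smul_eq_mul, Complex.sub_re,
      Complex.star_def, Complex.conj_ofReal, Complex.re_ofReal_mul] at e5' ⊢
    linear_combination (-ε / 2) * e5'
  rw [e2] at h1
  rw [e1] at h2
  -- `h2` gives `tr (s t) ≤ 1`, so the quadratic term is at most `ε ^ 2`.
  nlinarith [sq_nonneg ε]

/-- A Pinsker type lower bound on the relative entropy of two states, where the second one
is given in its spectral form. -/
theorem relEntropy_ge {A : Matrix ι ι ℂ} (hA : IsState A) {W : Matrix ι ι ℂ} (hW : Wᴴ * W = 1)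
    (hW' : W * Wᴴ = 1) {b : ι → ℝ} (hb : ∀ j, 0 ≤ b j) (hb1 : ∑ j, b j = 1)
    (hsupp : ∀ j, b j = 0 → (A * spec W (Pi.single j 1)).trace.re = 0) (ε : ℝ) :
    ε * traceNorm (A - spec W b) - ε ^ 2 ≤
      -entropy A - (A * spec W (fun j => Real.log (b j))).trace.re := by
  obtain ⟨U, hU, hU', hAU⟩ := exists_spec hA.1.isHermitian
  have hent := entropy_eq hA.1.isHermitian
  have ha := hA.1.eigenvalues_nonneg
  have ha1 := hA.sum_eigenvalues
  set a := hA.1.isHermitian.eigenvalues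
  clear_value a
  subst hAU
  -- With `Real.log 0 = 0` the relative entropy formula is wrong off the support of the second
  -- state; this shows that such terms carry no weight.
  have hP : ∀ i j, b j = 0 → a i * Complex.normSq ((Uᴴ * W) i j) = 0 := by
    intro i j hj
    have h := hsupp j hj
    rw [trace_spec_mul_spec, Finset.sum_eq_zero_iff_of_nonneg] at h
    · have h' := h i (Finset.mem_univ i)
      rw [Finset.sum_eq_single j] at h'
      · simpa using h'
      · intro k _ hk
        simp [Pi.single_eq_of_ne hk]
      · simp
    · intro i _
      refine Finset.sum_nonneg fun k _ => ?_
      have : (0 : ℝ) ≤ (Pi.single j 1 : ι → ℝ) k := by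
        by_cases hk : k = j
        · subst hk; simp
        · simp [Pi.single_eq_of_ne hk]
      exact mul_nonneg (mul_nonneg (ha i) this) (Complex.normSq_nonneg _)
  have hsq : ∀ (V : Matrix ι ι ℂ), Vᴴ * V = 1 → ∀ f : ι → ℝ, (∀ i, 0 ≤ f i) →
      spec V (fun i => √(f i)) * spec V (fun i => √(f i)) = spec V f := by
    intro V hV f hf
    rw [spec_mul_spec hV]
    congr 1
    ext i
    exact Real.mul_self_sqrt (hf i)
  have h1 := traceNorm_sub_le_trace_sq (isHermitian_spec U fun i => √(a i))
    (isHermitian_spec W fun i => √(b i))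
    (by rw [hsq U hU a ha, trace_spec hU, ha1]; simp)
    (by rw [hsq W hW b hb, trace_spec hW, hb1]; simp) ε
  rw [hsq U hU a ha, hsq W hW b hb] at h1
  refine h1.trans ?_
  have e1 : -entropy (spec U a) =
      ∑ i, ∑ j, a i * Real.log (a i) * 1 * Complex.normSq ((Uᴴ * W) i j) := by
    rw [← trace_spec_mul_spec U W (fun i => a i * Real.log (a i)) (fun _ => 1), spec_one hW',
      Matrix.mul_one, trace_spec hU, hent, Complex.ofReal_re, ← Finset.sum_neg_distrib]
    exact Finset.sum_congr rfl fun i _ => by rw [Real.negMulLog]; ring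
  -- The constant is spread over the same weights, so that both sides can be compared for each pair
  -- `(i, j)`.
  have e2 : (2 : ℝ) = 2 * ∑ i, ∑ j, a i * 1 * Complex.normSq ((Uᴴ * W) i j) := by
    rw [← trace_spec_mul_spec U W a (fun _ => 1), spec_one hW', Matrix.mul_one, trace_spec hU, ha1]
    simp
  conv_lhs => enter [1]; rw [e2]
  rw [e1, trace_spec_mul_spec, trace_spec_mul_spec]
  simp only [Finset.mul_sum, ← Finset.sum_sub_distrib]
  refine Finset.sum_le_sum fun i _ => Finset.sum_le_sum fun j _ => ?_
  rcases (Complex.normSq_nonneg ((Uᴴ * W) i j)).eq_or_lt with h0 | h0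
  · rw [← h0]; simp
  · have := mul_le_mul_of_nonneg_right (mul_log_sub_log_ge (ha i) (hb j) fun hj =>
      (mul_eq_zero.mp (hP i j hj)).resolve_right h0.ne') h0.le
    linarith

theorem trace_mul_re_nonneg {A B : Matrix ι ι ℂ} (hA : A.PosSemidef) (hB : B.PosSemidef) :
    0 ≤ (A * B).trace.re := by
  obtain ⟨U, -, -, h⟩ := exists_spec hA.isHermitian
  obtain ⟨W, -, -, h'⟩ := exists_spec hB.isHermitian
  rw [h, h', trace_spec_mul_spec]
  exact Finset.sum_nonneg fun i _ => Finset.sum_nonneg fun j _ => mul_nonneg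
    (mul_nonneg (hA.eigenvalues_nonneg i) (hB.eigenvalues_nonneg j)) (Complex.normSq_nonneg _)

/-- The entropy decrease under conditioning controls the average trace distance. -/
theorem sum_traceNorm_le_entropy_sub {κ : Type*} (s : Finset κ) {q : κ → ℝ} (hq : ∀ k, 0 ≤ q k)
    {R : κ → Matrix ι ι ℂ} {ρ : Matrix ι ι ℂ} (hρ : IsState ρ)
    (hR : ∀ k ∈ s, q k ≠ 0 → IsState (R k)) (hsum : ρ = ∑ k ∈ s, (q k : ℂ) • R k) (ε : ℝ) :
    ∑ k ∈ s, q k * (ε * traceNorm (R k - ρ) - ε ^ 2) ≤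
      entropy ρ - ∑ k ∈ s, q k * entropy (R k) := by
  obtain ⟨W, hW, hW', hρW⟩ := exists_spec hρ.1.isHermitian
  have hent := entropy_eq hρ.1.isHermitian
  have hb := hρ.1.eigenvalues_nonneg
  have hb1 := hρ.sum_eigenvalues
  set b := hρ.1.isHermitian.eigenvalues
  clear_value b
  have hlin : ∀ B : Matrix ι ι ℂ, ∑ k ∈ s, q k * (R k * B).trace.re = (ρ * B).trace.re := by
    intro B
    rw [hsum, Finset.sum_mul, trace_sum, Complex.re_sum]
    exact Finset.sum_congr rfl fun k _ => by
      rw [smul_mul, trace_smul, smul_eq_mul, Complex.re_ofReal_mul]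
  have hterm : ∀ k ∈ s, q k * (ε * traceNorm (R k - ρ) - ε ^ 2) ≤
      q k * (-entropy (R k) - (R k * spec W (fun j => Real.log (b j))).trace.re) := by
    intro k hk
    rcases eq_or_ne (q k) 0 with h0 | h0
    · rw [h0]; simp
    refine mul_le_mul_of_nonneg_left ?_ (hq k)
    rw [hρW]
    refine relEntropy_ge (hR k hk h0) hW hW' hb hb1 (fun j hj => ?_) ε
    have h1 := hlin (spec W (Pi.single j 1))
    have h2 : (ρ * spec W (Pi.single j 1)).trace.re = 0 := by
      rw [hρW, spec_mul_spec hW, trace_spec hW, Complex.ofReal_re, Finset.sum_eq_zero]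
      intro i _
      by_cases hi : i = j
      · rw [hi, hj, zero_mul]
      · rw [Pi.single_eq_of_ne hi, mul_zero]
    -- A mixture with no weight on a null direction of `ρ` has no component with weight there.
    rw [h2, Finset.sum_eq_zero_iff_of_nonneg] at h1
    · exact (mul_eq_zero.mp (h1 k hk)).resolve_left h0
    · intro l hl
      rcases eq_or_ne (q l) 0 with h0 | h0
      · rw [h0, zero_mul]
      refine mul_nonneg (hq l) (trace_mul_re_nonneg (hR l hl h0).1 (posSemidef_spec W fun i => ?_))
      by_cases hi : i = j
      · subst hi; simp
      · simp [Pi.single_eq_of_ne hi]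
  -- The average relative entropy to the mean is the Holevo quantity, because `tr (R k log ρ)` is
  -- linear in `R k`.
  refine (Finset.sum_le_sum hterm).trans_eq ?_
  simp only [mul_sub, Finset.sum_sub_distrib, hlin]
  have : (ρ * spec W (fun j => Real.log (b j))).trace.re = -entropy ρ := by
    rw [hent]
    conv_lhs => rw [hρW]
    rw [spec_mul_spec hW, trace_spec hW, Complex.ofReal_re, ← Finset.sum_neg_distrib]
    exact Finset.sum_congr rfl fun i _ => by rw [Real.negMulLog]; ring
  rw [this]
  simp only [mul_neg, Finset.sum_neg_distrib]
  ring

/-- The entropy of an unnormalised state, weighted by its trace. -/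
noncomputable def weightedEntropy (R : Matrix ι ι ℂ) : ℝ :=
  R.trace.re * entropy ((R.trace.re⁻¹ : ℂ) • R)

theorem weightedEntropy_nonneg {R : Matrix ι ι ℂ} (hR : R.PosSemidef) : 0 ≤ weightedEntropy R := by
  rcases eq_or_ne R.trace.re 0 with h | h
  · rw [weightedEntropy, h, zero_mul]
  · exact mul_nonneg (trace_re_nonneg hR) (entropy_nonneg (isState_normalize hR h))

theorem weightedEntropy_le {R : Matrix ι ι ℂ} (hR : IsState R) :
    weightedEntropy R ≤ Real.log (Fintype.card ι) := by
  simpa [weightedEntropy, hR.2] using entropy_le_log_card hR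

/-- The previous bound multiplied by `tr ρ`. In this homogeneous form it can be summed over outcomes
without dividing by their probabilities, and outcomes of probability zero need no exclusion. -/
theorem sum_traceNorm_le_weightedEntropy_sub {κ : Type*} (s : Finset κ) {R : κ → Matrix ι ι ℂ}
    (hR : ∀ k ∈ s, (R k).PosSemidef) {ρ : Matrix ι ι ℂ} (hsum : ρ = ∑ k ∈ s, R k) {ε : ℝ}
    (hε : 0 ≤ ε) :
    ε * ∑ k ∈ s, traceNorm (R k - (((R k).trace.re / ρ.trace.re : ℝ) : ℂ) • ρ) -
        ε ^ 2 * ρ.trace.re ≤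
      weightedEntropy ρ - ∑ k ∈ s, weightedEntropy (R k) := by
  have hρ : ρ.PosSemidef := hsum ▸ posSemidef_sum s hR
  have htr : ρ.trace.re = ∑ k ∈ s, (R k).trace.re := by
    rw [hsum, trace_sum, Complex.re_sum]
  have hnn : ∀ k ∈ s, 0 ≤ (R k).trace.re := fun k hk => trace_re_nonneg (hR k hk)
  have hzero : ∀ A : Matrix ι ι ℂ, A.PosSemidef → A.trace.re = 0 → A = 0 := by
    intro A hA h
    rw [← hA.trace_eq_zero_iff, trace_eq_re hA, h, Complex.ofReal_zero]
  rcases eq_or_ne ρ.trace.re 0 with h0 | h0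
  · have hR0 : ∀ k ∈ s, R k = 0 := by
      intro k hk
      rw [h0] at htr
      exact hzero _ (hR k hk) ((Finset.sum_eq_zero_iff_of_nonneg hnn).mp htr.symm k hk)
    rw [Finset.sum_eq_zero, Finset.sum_eq_zero]
    · simp [weightedEntropy, h0]
    · intro k hk
      simp [weightedEntropy, hR0 k hk]
    · intro k hk
      rw [hR0 k hk, hzero ρ hρ h0]
      simp [traceNorm_zero]
  set p := ρ.trace.re with hp
  have hpp : 0 < p := (trace_re_nonneg hρ).lt_of_ne (Ne.symm h0)
  classical
  set q : κ → ℝ := fun k => if k ∈ s then (R k).trace.re / p else 0 with hqdef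
  have hq : ∀ k ∈ s, q k = (R k).trace.re / p := fun k hk => by simp [hqdef, hk]
  have hq0 : ∀ k, 0 ≤ q k := by
    intro k
    simp only [hqdef]
    split_ifs with hk
    · exact div_nonneg (hnn k hk) hpp.le
    · exact le_rfl
  have hnorm : ∀ k ∈ s, R k = ((R k).trace.re : ℂ) • (((R k).trace.re⁻¹ : ℂ) • R k) := by
    intro k hk
    rcases eq_or_ne (R k).trace.re 0 with h | h
    · conv_lhs => rw [hzero _ (hR k hk) h]
      rw [h]
      simp
    · rw [smul_smul, mul_inv_cancel₀ (by exact_mod_cast h), one_smul]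
  have hρn : ((p⁻¹ : ℂ) • ρ) = ∑ k ∈ s, (q k : ℂ) • (((R k).trace.re⁻¹ : ℂ) • R k) := by
    conv_lhs => rw [hsum, Finset.smul_sum]
    refine Finset.sum_congr rfl fun k hk => ?_
    conv_lhs => rw [hnorm k hk]
    rw [smul_smul, hq k hk]
    congr 1
    push_cast
    ring
  have hρs : IsState ((p⁻¹ : ℂ) • ρ) := isState_normalize hρ h0
  have hRs : ∀ k ∈ s, q k ≠ 0 → IsState (((R k).trace.re⁻¹ : ℂ) • R k) := by
    intro k hk h
    refine isState_normalize (hR k hk) fun h' => h ?_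
    rw [hq k hk, h', zero_div]
  have key := sum_traceNorm_le_entropy_sub s hq0 hρs hRs hρn ε
  have key2 := mul_le_mul_of_nonneg_left key hpp.le
  have hqsum : ∑ k ∈ s, q k = 1 := by
    rw [Finset.sum_congr rfl hq, ← Finset.sum_div, ← htr, div_self h0]
  have e1 : p * (entropy ((p⁻¹ : ℂ) • ρ) -
      ∑ k ∈ s, q k * entropy (((R k).trace.re⁻¹ : ℂ) • R k)) =
      weightedEntropy ρ - ∑ k ∈ s, weightedEntropy (R k) := by
    rw [mul_sub, Finset.mul_sum]
    congr 1
    refine Finset.sum_congr rfl fun k hk => ?_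
    rw [hq k hk, weightedEntropy]
    field_simp
  rw [e1] at key2
  refine le_trans ?_ key2
  simp only [mul_sub, Finset.sum_sub_distrib, ← Finset.sum_mul, hqsum]
  rw [one_mul, mul_comm (ε ^ 2), Finset.mul_sum, Finset.mul_sum]
  refine sub_le_sub_right (Finset.sum_le_sum fun k hk => ?_) _
  have hle : traceNorm (R k - (((R k).trace.re / p : ℝ) : ℂ) • ρ) ≤
      (R k).trace.re * traceNorm (((R k).trace.re⁻¹ : ℂ) • R k - (p⁻¹ : ℂ) • ρ) := by
    rcases eq_or_ne (R k).trace.re 0 with h | h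
    · rw [hzero _ (hR k hk) h]
      simp [traceNorm_zero]
    · have hh : (((R k).trace.re⁻¹ : ℂ) • R k - (p⁻¹ : ℂ) • ρ).IsHermitian :=
        (isState_normalize (hR k hk) h).1.isHermitian.sub hρs.1.isHermitian
      have := traceNorm_smul_le hh (hnn k hk)
      rwa [smul_sub, ← hnorm k hk, smul_smul, ← Complex.ofReal_inv p, ← Complex.ofReal_mul,
        ← div_eq_mul_inv, Complex.ofReal_inv p] at this
  calc _ ≤ ε * ((R k).trace.re * traceNorm (((R k).trace.re⁻¹ : ℂ) • R k - (p⁻¹ : ℂ) • ρ)) :=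
        mul_le_mul_of_nonneg_left hle hε
    _ = _ := by rw [hq k hk]; field_simp

end Entropy

end QuditState

namespace QuditState

open Matrix
open scoped MatrixOrder ComplexOrder

/-! ### Tensor products and convex mixtures. -/

section Tensor

variable {V : Type*} [Fintype V] {d : ℕ}

theorem tensor_conjTranspose (T : V → Matrix (Fin d) (Fin d) ℂ) :
    (tensor T)ᴴ = tensor (fun v => (T v)ᴴ) := by
  ext x y
  simp [tensor]

theorem tensor_mul [DecidableEq V] (S T : V → Matrix (Fin d) (Fin d) ℂ) :
    tensor S * tensor T = tensor (fun v => S v * T v) := by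
  ext x y
  simp only [tensor, Matrix.mul_apply, of_apply, ← Finset.prod_mul_distrib]
  rw [Finset.prod_univ_sum, Fintype.piFinset_univ]

theorem trace_tensor [DecidableEq V] (T : V → Matrix (Fin d) (Fin d) ℂ) :
    (tensor T).trace = ∏ v, (T v).trace := by
  simp only [Matrix.trace, diag_apply, tensor, of_apply]
  rw [Finset.prod_univ_sum, Fintype.piFinset_univ]

theorem exists_conjTranspose_mul_self {ι : Type*} [Fintype ι] [DecidableEq ι] {A : Matrix ι ι ℂ}
    (hA : A.PosSemidef) : ∃ B : Matrix ι ι ℂ, A = Bᴴ * B := by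
  obtain ⟨U, hU, -, h⟩ := exists_spec hA.isHermitian
  refine ⟨spec U fun i => √(hA.isHermitian.eigenvalues i), ?_⟩
  rw [(isHermitian_spec _ _).eq, spec_mul_spec hU]
  simpa only [Real.mul_self_sqrt (hA.eigenvalues_nonneg _)] using h

theorem posSemidef_tensor [DecidableEq V] {T : V → Matrix (Fin d) (Fin d) ℂ}
    (hT : ∀ v, (T v).PosSemidef) : (tensor T).PosSemidef := by
  choose B hB using fun v => exists_conjTranspose_mul_self (hT v)
  obtain rfl : T = fun v => (B v)ᴴ * B v := funext hB
  rw [← tensor_mul, ← tensor_conjTranspose]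
  exact posSemidef_conjTranspose_mul_self _

theorem isState_tensor [DecidableEq V] {T : V → Matrix (Fin d) (Fin d) ℂ}
    (hT : ∀ v, IsState (T v)) : IsState (tensor T) := by
  refine ⟨posSemidef_tensor fun v => (hT v).1, ?_⟩
  rw [trace_tensor, Finset.prod_eq_one fun v _ => (hT v).2]

theorem isState_convex {κ ι : Type*} [Fintype ι] (s : Finset κ) {p : κ → ℝ} (hp : ∀ z ∈ s, 0 ≤ p z)
    (hp1 : ∑ z ∈ s, p z = 1) {τ : κ → Matrix ι ι ℂ} (hτ : ∀ z ∈ s, IsState (τ z)) :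
    IsState (∑ z ∈ s, (p z : ℂ) • τ z) := by
  constructor
  · refine posSemidef_sum _ fun z hz => (hτ z hz).1.smul ?_
    exact_mod_cast hp z hz
  · rw [trace_sum, ← Complex.ofReal_one, ← hp1, Complex.ofReal_sum]
    exact Finset.sum_congr rfl fun z hz => by rw [trace_smul, (hτ z hz).2]; simp

theorem isGloballySeparable_sum {κ : Type*} (s : Finset κ) {p : κ → ℝ} (hp : ∀ z ∈ s, 0 ≤ p z)
    (hp1 : ∑ z ∈ s, p z = 1) {τ : κ → V → Matrix (Fin d) (Fin d) ℂ}
    (hτ : ∀ z ∈ s, ∀ v, IsState (τ z v)) :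
    IsGloballySeparable (∑ z ∈ s, (p z : ℂ) • tensor (τ z)) := by
  refine ⟨s.card, fun k => p (s.equivFin.symm k), fun k => τ (s.equivFin.symm k),
    fun k => hp _ (s.equivFin.symm k).2, ?_, fun k => hτ _ (s.equivFin.symm k).2, ?_⟩
  · rw [← hp1, ← Finset.sum_coe_sort s]
    exact s.equivFin.symm.sum_comp fun z => p z
  · rw [← Finset.sum_coe_sort s]
    exact (s.equivFin.symm.sum_comp fun z => (p z : ℂ) • tensor (τ z)).symm

end Tensor

/-! ### Partial traces. -/

section Marginal

variable {V : Type*} [Fintype V] [DecidableEq V] {d : ℕ}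

theorem marginal_smul (S : Finset V) (c : ℂ) (ρ : Op V d) :
    marginal S (c • ρ) = c • marginal S ρ := by
  ext x y
  simp [marginal, Finset.mul_sum]

theorem marginal_sum (S : Finset V) {κ : Type*} (s : Finset κ) (ρ : κ → Op V d) :
    marginal S (∑ z ∈ s, ρ z) = ∑ z ∈ s, marginal S (ρ z) := by
  ext x y
  simp only [marginal, of_apply, Matrix.sum_apply]
  exact Finset.sum_comm

theorem marginal_tensor (S : Finset V) {T : V → Matrix (Fin d) (Fin d) ℂ}
    (hT : ∀ v ∉ S, (T v).trace = 1) :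
    marginal S (tensor T) = tensor (fun v : {v // v ∈ S} => T v) := by
  ext x y
  have h1 : ∀ z : {v // v ∉ S} → Fin d,
      tensor T ((Equiv.piEquivPiSubtypeProd (fun v => v ∈ S) (fun _ => Fin d)).symm (x, z))
        ((Equiv.piEquivPiSubtypeProd (fun v => v ∈ S) (fun _ => Fin d)).symm (y, z)) =
      (∏ v : {v // v ∈ S}, T v (x v) (y v)) * ∏ v : {v // v ∉ S}, T v (z v) (z v) := by
    intro z
    rw [tensor, of_apply, ← Fintype.prod_subtype_mul_prod_subtype (fun v => v ∈ S)]
    congr 1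
    · exact Finset.prod_congr (Finset.ext fun _ => by simp) fun v _ => by
        simp [Equiv.piEquivPiSubtypeProd]
    · exact Finset.prod_congr rfl fun v _ => by simp [Equiv.piEquivPiSubtypeProd, v.2]
  have h2 : ∑ z : {v // v ∉ S} → Fin d, ∏ v : {v // v ∉ S}, T v (z v) (z v) = 1 := by
    have := Finset.prod_univ_sum (fun _ : {v // v ∉ S} => (Finset.univ : Finset (Fin d)))
      (fun v a => T v a a)
    rw [Fintype.piFinset_univ] at this
    rw [← this]
    exact Finset.prod_eq_one fun v _ => hT v v.2
  simp only [marginal, of_apply, h1]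
  rw [← Finset.mul_sum, h2, mul_one, tensor, of_apply]

theorem isState_marginal (S : Finset V) {ρ : Op V d} (hρ : IsState ρ) :
    IsState (marginal S ρ) := by
  constructor
  · have : marginal S ρ = ∑ z : {v // v ∉ S} → Fin d, ρ.submatrix
        (fun x => (Equiv.piEquivPiSubtypeProd (fun v => v ∈ S) (fun _ => Fin d)).symm (x, z))
        (fun x => (Equiv.piEquivPiSubtypeProd (fun v => v ∈ S) (fun _ => Fin d)).symm (x, z)) := by
      ext x y
      simp [marginal, Matrix.sum_apply]
    rw [this]
    exact posSemidef_sum _ fun z _ => hρ.1.submatrix _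
  · rw [← hρ.2, Matrix.trace, Matrix.trace, ← (Equiv.piEquivPiSubtypeProd (fun v => v ∈ S)
      (fun _ => Fin d)).symm.sum_comp, Fintype.sum_prod_type]
    rfl

end Marginal

/-! ### Expectations of product operators and conditional states of one site. -/

section Contraction

variable {V : Type*} [Fintype V] [DecidableEq V] {d : ℕ}

/-- The expectation `tr(ρ ⨂ T_v)`, as a multilinear map in `T`. -/
noncomputable def contraction (ρ : Op V d) :
    MultilinearMap ℂ (fun _ : V => Matrix (Fin d) (Fin d) ℂ) ℂ :=
  ∑ x, ∑ y, ρ x y • (MultilinearMap.mkPiAlgebra ℂ V ℂ).compLinearMap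
    (fun v => Matrix.entryLinearMap ℂ ℂ (y v) (x v))

theorem contraction_apply (ρ : Op V d) (T : V → Matrix (Fin d) (Fin d) ℂ) :
    contraction ρ T = ∑ x, ∑ y, ρ x y * ∏ v, T v (y v) (x v) := by
  simp [contraction]

theorem contraction_eq_trace (ρ : Op V d) (T : V → Matrix (Fin d) (Fin d) ℂ) :
    contraction ρ T = (ρ * tensor T).trace := by
  rw [contraction_apply]
  simp [Matrix.trace, Matrix.mul_apply, tensor]

theorem contraction_re_nonneg {ρ : Op V d} (hρ : ρ.PosSemidef)
    {T : V → Matrix (Fin d) (Fin d) ℂ} (hT : ∀ v, (T v).PosSemidef) :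
    0 ≤ (contraction ρ T).re := by
  rw [contraction_eq_trace]
  exact trace_mul_re_nonneg hρ (posSemidef_tensor hT)

theorem star_contraction {ρ : Op V d} (hρ : ρ.IsHermitian) (T : V → Matrix (Fin d) (Fin d) ℂ) :
    star (contraction ρ T) = contraction ρ (fun v => (T v)ᴴ) := by
  rw [contraction_eq_trace, contraction_eq_trace, ← trace_conjTranspose, conjTranspose_mul, hρ.eq,
    tensor_conjTranspose, Matrix.trace_mul_comm]

theorem contraction_one (ρ : Op V d) : contraction ρ (fun _ => 1) = ρ.trace := by
  rw [contraction_eq_trace]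
  have : tensor (fun _ : V => (1 : Matrix (Fin d) (Fin d) ℂ)) = 1 := by
    ext x y
    simp only [tensor, of_apply, one_apply, Finset.prod_ite_zero, Finset.prod_const_one]
    simp [funext_iff]
  rw [this, Matrix.mul_one]

/-- The unnormalised state of site `i` after the effects `T` on the other sites. -/
noncomputable def siteOp (ρ : Op V d) (T : V → Matrix (Fin d) (Fin d) ℂ) (i : V) :
    Matrix (Fin d) (Fin d) ℂ :=
  Matrix.of fun a b => contraction ρ (Function.update T i (Matrix.single b a 1))

theorem contraction_update (ρ : Op V d) (T : V → Matrix (Fin d) (Fin d) ℂ) (i : V)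
    (A : Matrix (Fin d) (Fin d) ℂ) :
    contraction ρ (Function.update T i A) = (A * siteOp ρ T i).trace := by
  conv_lhs => rw [Matrix.matrix_eq_sum_single A]
  rw [MultilinearMap.map_update_sum, Matrix.trace]
  refine Finset.sum_congr rfl fun b _ => ?_
  rw [MultilinearMap.map_update_sum, diag_apply, Matrix.mul_apply]
  refine Finset.sum_congr rfl fun a _ => ?_
  rw [siteOp, of_apply, ← smul_eq_mul, ← MultilinearMap.map_update_smul, smul_single, smul_eq_mul,
    mul_one]

theorem trace_siteOp (ρ : Op V d) (T : V → Matrix (Fin d) (Fin d) ℂ) (i : V) :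
    (siteOp ρ T i).trace = contraction ρ (Function.update T i 1) := by
  rw [contraction_update, Matrix.one_mul]

theorem posSemidef_siteOp {ρ : Op V d} (hρ : ρ.PosSemidef) {T : V → Matrix (Fin d) (Fin d) ℂ}
    (hT : ∀ v, (T v).PosSemidef) (i : V) : (siteOp ρ T i).PosSemidef := by
  have hH : (siteOp ρ T i).IsHermitian := by
    ext a b
    rw [conjTranspose_apply, siteOp, of_apply, of_apply, star_contraction hρ.isHermitian]
    congr 1
    ext1 v
    by_cases hv : v = i
    · subst hv
      simp
    · simp [hv, (hT v).isHermitian.eq]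
  refine PosSemidef.of_dotProduct_mulVec_nonneg hH fun x => ?_
  have hre : 0 ≤ (star x ⬝ᵥ siteOp ρ T i *ᵥ x).re := by
    -- The quadratic form at `x` is the expectation of a product of positive operators, with the
    -- rank-one operator of `x` at site `i`.
    have e : star x ⬝ᵥ siteOp ρ T i *ᵥ x =
        contraction ρ (Function.update T i (vecMulVec x (star x))) := by
      rw [contraction_update, Matrix.trace_mul_comm, Matrix.mul_vecMulVec, trace_vecMulVec,
        dotProduct_comm]
    rw [e]
    refine contraction_re_nonneg hρ fun v => ?_
    by_cases hv : v = i
    · subst hv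
      simpa using posSemidef_vecMulVec_self_star x
    · simpa [hv] using hT v
  have him : (star x ⬝ᵥ siteOp ρ T i *ᵥ x).im = 0 := by
    have := hH.im_star_dotProduct_mulVec_self x
    simpa using this
  exact Complex.le_def.mpr ⟨by simpa using hre, by simpa using him.symm⟩

theorem siteOp_update_sum (ρ : Op V d) (T : V → Matrix (Fin d) (Fin d) ℂ) {i j : V} (hij : i ≠ j)
    {κ : Type*} (s : Finset κ) (E : κ → Matrix (Fin d) (Fin d) ℂ) :
    siteOp ρ (Function.update T j (∑ k ∈ s, E k)) i =
      ∑ k ∈ s, siteOp ρ (Function.update T j (E k)) i := by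
  ext a b
  simp only [siteOp, of_apply, Matrix.sum_apply]
  rw [Function.update_comm hij.symm, MultilinearMap.map_update_sum]
  exact Finset.sum_congr rfl fun k _ => by rw [Function.update_comm hij.symm]

/-- Identities outside `{i, j}` trace out those sites and the matrix units select the entry.
Marginals thereby become values of a multilinear map, in which sums of effects can be expanded. -/
theorem marginal_pair_apply (ρ : Op V d) {i j : V} (hij : i ≠ j) {S : Finset V} (hS : S = {i, j})
    (hi : i ∈ S) (hj : j ∈ S) (x y : {v // v ∈ S} → Fin d) :
    marginal S ρ x y = contraction ρ (Function.update (Function.update (fun _ => 1) i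
      (Matrix.single (y ⟨i, hi⟩) (x ⟨i, hi⟩) 1)) j (Matrix.single (y ⟨j, hj⟩) (x ⟨j, hj⟩) 1)) := by
  rw [contraction_apply]
  set e := Equiv.piEquivPiSubtypeProd (fun v => v ∈ S) (fun _ => Fin d)
  have hprod : ∀ (f g : {v // v ∈ S} → Fin d) (z w : {v // v ∉ S} → Fin d),
      ∏ v, (Function.update (Function.update (fun _ => (1 : Matrix (Fin d) (Fin d) ℂ)) i
        (Matrix.single (y ⟨i, hi⟩) (x ⟨i, hi⟩) 1)) j
          (Matrix.single (y ⟨j, hj⟩) (x ⟨j, hj⟩) 1)) v (e.symm (g, w) v) (e.symm (f, z) v) =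
      if f = x ∧ g = y ∧ z = w then 1 else 0 := by
    intro f g z w
    split_ifs with h
    · obtain ⟨rfl, rfl, rfl⟩ := h
      refine Finset.prod_eq_one fun v _ => ?_
      by_cases hvj : v = j
      · subst hvj
        simp [e, Equiv.piEquivPiSubtypeProd, hj]
      by_cases hvi : v = i
      · subst hvi
        simp [e, Equiv.piEquivPiSubtypeProd, hi, hvj]
      have hv : v ∉ S := by simp [hS, hvi, hvj]
      simp [e, Equiv.piEquivPiSubtypeProd, hv, hvi, hvj]
    · by_contra hne
      rw [← ne_eq, Finset.prod_ne_zero_iff] at hne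
      refine h ⟨?_, ?_, ?_⟩
      · ext1 ⟨v, hv⟩
        have h1 := hne v (Finset.mem_univ v)
        have hv' := hv
        rw [hS, Finset.mem_insert, Finset.mem_singleton] at hv'
        rcases hv' with rfl | rfl
        · simp [e, Equiv.piEquivPiSubtypeProd, hv, hij, Matrix.single_apply] at h1
          exact h1.2.symm
        · simp [e, Equiv.piEquivPiSubtypeProd, hv, Matrix.single_apply] at h1
          exact h1.2.symm
      · ext1 ⟨v, hv⟩
        have h1 := hne v (Finset.mem_univ v)
        have hv' := hv
        rw [hS, Finset.mem_insert, Finset.mem_singleton] at hv'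
        rcases hv' with rfl | rfl
        · simp [e, Equiv.piEquivPiSubtypeProd, hv, hij, Matrix.single_apply] at h1
          exact h1.1.symm
        · simp [e, Equiv.piEquivPiSubtypeProd, hv, Matrix.single_apply] at h1
          exact h1.1.symm
      · ext1 ⟨v, hv⟩
        have h1 := hne v (Finset.mem_univ v)
        have hvi : v ≠ i := fun h => hv (h ▸ hi)
        have hvj : v ≠ j := fun h => hv (h ▸ hj)
        simp [e, Equiv.piEquivPiSubtypeProd, hv, hvi, hvj, Matrix.one_apply] at h1
        exact h1.symm
  rw [← e.symm.sum_comp, Fintype.sum_prod_type]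
  have : ∀ f z, ∑ b, ρ (e.symm (f, z)) b * ∏ v, (Function.update (Function.update
      (fun _ => (1 : Matrix (Fin d) (Fin d) ℂ)) i
        (Matrix.single (y ⟨i, hi⟩) (x ⟨i, hi⟩) 1)) j
          (Matrix.single (y ⟨j, hj⟩) (x ⟨j, hj⟩) 1)) v (b v) (e.symm (f, z) v) =
      if f = x then ρ (e.symm (x, z)) (e.symm (y, z)) else 0 := by
    intro f z
    rw [← e.symm.sum_comp, Fintype.sum_prod_type]
    simp only [hprod]
    split_ifs with h
    · subst h
      rw [Finset.sum_eq_single y, Finset.sum_eq_single z]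
      · simp
      · intro w _ hw
        simp [hw.symm]
      · simp
      · intro g _ hg
        simp [hg]
      · simp
    · simp [h]
  simp only [this]
  rw [Finset.sum_eq_single x]
  · simp [marginal, e]
  · intro f _ hf
    simp [hf]
  · simp

end Contraction

end QuditState

namespace QuditState

open Matrix
open scoped MatrixOrder ComplexOrder

/-! ### An informationally complete measurement with an explicit dual frame. -/

section PhaseMeasurement

variable {d : ℕ}

/-- A primitive cube root of unity. -/
noncomputable def cubeRoot : ℂ := Complex.exp (2 * Real.pi * Complex.I / (3 : ℕ))

theorem isPrimitiveRoot_cubeRoot : IsPrimitiveRoot cubeRoot 3 :=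
  Complex.isPrimitiveRoot_exp 3 (by norm_num)

theorem star_cubeRoot : star cubeRoot = cubeRoot ^ 2 := by
  have h3 := isPrimitiveRoot_cubeRoot.pow_eq_one
  have hn : ‖cubeRoot‖ = 1 := isPrimitiveRoot_cubeRoot.norm'_eq_one (by norm_num)
  have h0 : cubeRoot ≠ 0 := isPrimitiveRoot_cubeRoot.ne_zero (by norm_num)
  have h1 : cubeRoot * star cubeRoot = 1 := by
    rw [Complex.star_def, Complex.mul_conj, Complex.normSq_eq_norm_sq, hn]
    simp
  refine mul_left_cancel₀ h0 (h1.trans ?_)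
  rw [← pow_succ', h3]

theorem sum_cubeRoot_pow (n : ℕ) :
    ∑ t : Fin 3, cubeRoot ^ ((t : ℕ) * n) = if 3 ∣ n then 3 else 0 := by
  have hrange : ∑ t : Fin 3, cubeRoot ^ ((t : ℕ) * n) =
      ∑ t ∈ Finset.range 3, (cubeRoot ^ n) ^ t := by
    rw [Finset.sum_range]
    exact Finset.sum_congr rfl fun t _ => by rw [← pow_mul, mul_comm]
  rw [hrange]
  split_ifs with h
  · rw [(isPrimitiveRoot_cubeRoot.pow_eq_one_iff_dvd n).mpr h]
    simp
  · have h1 : cubeRoot ^ n ≠ 1 := fun h' => h ((isPrimitiveRoot_cubeRoot.pow_eq_one_iff_dvd n).mp h')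
    rw [geom_sum_eq h1, ← pow_mul, mul_comm n, pow_mul, isPrimitiveRoot_cubeRoot.pow_eq_one]
    simp

theorem sum_prod_cubeRoot_pow (n : Fin d → ℕ) :
    ∑ z : Fin d → Fin 3, ∏ v, cubeRoot ^ ((z v : ℕ) * n v) =
      if ∀ v, 3 ∣ n v then (3 : ℂ) ^ d else 0 := by
  have h := Finset.prod_univ_sum (fun _ : Fin d => (Finset.univ : Finset (Fin 3)))
    (fun v t => cubeRoot ^ ((t : ℕ) * n v))
  rw [Fintype.piFinset_univ] at h
  rw [← h]
  simp only [sum_cubeRoot_pow]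
  rw [Finset.prod_ite_zero]
  simp

/-- The vector with entries `ω ^ z_a`. -/
noncomputable def phaseVector (z : Fin d → Fin 3) : Fin d → ℂ := fun a => cubeRoot ^ (z a : ℕ)

theorem phaseVector_eq_prod (z : Fin d → Fin 3) (a : Fin d) :
    phaseVector z a = ∏ v, cubeRoot ^ ((z v : ℕ) * if v = a then 1 else 0) := by
  rw [Finset.prod_eq_single a]
  · simp [phaseVector]
  · intro v _ hv
    simp [hv]
  · simp

theorem star_phaseVector_eq_prod (z : Fin d → Fin 3) (a : Fin d) :
    star (phaseVector z a) = ∏ v, cubeRoot ^ ((z v : ℕ) * if v = a then 2 else 0) := by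
  rw [Finset.prod_eq_single a]
  · rw [phaseVector, star_pow, star_cubeRoot, ← pow_mul, mul_comm]
    simp
  · intro v _ hv
    simp [hv]
  · simp

theorem sum_phaseVector_two (a b : Fin d) :
    ∑ z, phaseVector z b * star (phaseVector z a) = if a = b then (3 : ℂ) ^ d else 0 := by
  simp only [star_phaseVector_eq_prod]
  simp only [phaseVector_eq_prod]
  simp only [← Finset.prod_mul_distrib, ← pow_add, ← mul_add]
  rw [sum_prod_cubeRoot_pow]
  refine if_congr ⟨fun h => ?_, fun h v => ?_⟩ rfl rfl
  · by_contra hab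
    have := h a
    simp [hab] at this
  · subst h
    split_ifs <;> simp

theorem sum_phaseVector_four (a b c e : Fin d) :
    ∑ z, (phaseVector z b * star (phaseVector z a)) * (phaseVector z c * star (phaseVector z e)) =
      if (a = b ∧ c = e) ∨ (a = c ∧ b = e) then (3 : ℂ) ^ d else 0 := by
  simp only [star_phaseVector_eq_prod]
  simp only [phaseVector_eq_prod]
  simp only [← Finset.prod_mul_distrib, ← pow_add, ← mul_add]
  rw [sum_prod_cubeRoot_pow]
  refine if_congr ⟨fun h => ?_, fun h v => ?_⟩ rfl rfl
  · have hb := h b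
    have hc := h c
    clear h
    by_cases h1 : a = b
    · subst h1
      by_cases h2 : c = e
      · exact Or.inl ⟨rfl, h2⟩
      · by_cases h3 : a = c
        · subst h3
          simp [h2] at hc
        · simp [h2, Ne.symm h3] at hc
    · by_cases h2 : b = e
      · subst h2
        by_cases h3 : a = c
        · exact Or.inr ⟨h3, rfl⟩
        · by_cases h4 : c = b
          · subst h4
            simp [Ne.symm h1] at hb
          · simp [h4, Ne.symm h3] at hc
      · by_cases h3 : b = c
        · subst h3
          simp [h2, Ne.symm h1] at hb
        · simp [h2, h3, Ne.symm h1] at hb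
  · rcases h with ⟨rfl, rfl⟩ | ⟨rfl, rfl⟩ <;> split_ifs <;> simp

/-- Projector onto the (unnormalised) phase vector. -/
noncomputable def phaseProj (z : Fin d → Fin 3) : Matrix (Fin d) (Fin d) ℂ :=
  vecMulVec (phaseVector z) (star (phaseVector z))

theorem trace_phaseProj (z : Fin d → Fin 3) : (phaseProj z).trace = d := by
  have hn : ‖cubeRoot‖ = 1 := isPrimitiveRoot_cubeRoot.norm'_eq_one (by norm_num)
  rw [phaseProj, trace_vecMulVec, dotProduct]
  have : ∀ a, phaseVector z a * star (phaseVector z) a = 1 := by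
    intro a
    rw [Pi.star_apply, Complex.star_def, Complex.mul_conj, Complex.normSq_eq_norm_sq, phaseVector,
      norm_pow, hn]
    simp
  rw [Finset.sum_congr rfl fun a _ => this a]
  simp

theorem sum_phaseProj : ∑ z, phaseProj z = ((3 : ℂ) ^ d) • (1 : Matrix (Fin d) (Fin d) ℂ) := by
  ext b a
  simp only [Matrix.sum_apply, phaseProj, vecMulVec_apply, Pi.star_apply, sum_phaseVector_two,
    Matrix.smul_apply, one_apply, smul_eq_mul]
  by_cases h : a = b
  · simp [h]
  · simp [h, Ne.symm h]

/-- The two pairings of the fourth moment give `X` and `X.trace • 1`; they overlap when all indices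
agree, whence the subtracted diagonal. -/
theorem sum_trace_phaseProj_smul (X : Matrix (Fin d) (Fin d) ℂ) :
    ∑ z, (phaseProj z * X).trace • phaseProj z =
      ((3 : ℂ) ^ d) • (X + X.trace • 1 - diagonal (fun a => X a a)) := by
  ext c e
  have h1 : ∀ z : Fin d → Fin 3, ((phaseProj z * X).trace • phaseProj z) c e =
      ∑ b, ∑ a, X a b * ((phaseVector z b * star (phaseVector z a)) *
        (phaseVector z c * star (phaseVector z e))) := by
    intro z
    rw [Matrix.smul_apply, Matrix.trace, smul_eq_mul, Finset.sum_mul]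
    refine Finset.sum_congr rfl fun b _ => ?_
    rw [diag_apply, Matrix.mul_apply, Finset.sum_mul]
    refine Finset.sum_congr rfl fun a _ => ?_
    simp only [phaseProj, vecMulVec_apply, Pi.star_apply]
    ring
  simp only [Matrix.sum_apply, h1]
  rw [Finset.sum_comm]
  simp only [Finset.sum_comm (s := (Finset.univ : Finset (Fin d → Fin 3))), ← Finset.mul_sum,
    sum_phaseVector_four]
  by_cases hce : c = e
  · subst hce
    have : ∀ a b, (a = b ∨ (a = c ∧ b = c)) ↔ a = b := by
      intro a b
      constructor
      · rintro (h | ⟨rfl, rfl⟩)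
        · exact h
        · rfl
      · exact Or.inl
    simp only [and_true, this]
    simp [Matrix.trace, Finset.mul_sum, mul_comm]
  · have : ∀ a b, ((a = b ∧ c = e) ∨ (a = c ∧ b = e)) ↔ (a = c ∧ b = e) := by
      intro a b
      simp [hce]
    simp only [this, ite_and]
    simp [hce, mul_comm]

theorem posSemidef_single (a : Fin d) : (single a a (1 : ℂ)).PosSemidef := by
  rw [← diagonal_single]
  refine PosSemidef.diagonal fun b => ?_
  by_cases h : b = a
  · subst h; simp
  · simp [Pi.single_eq_of_ne h]

/-- An informationally complete measurement on `ℂ^d` together with a dual frame. -/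
theorem exists_measurement (hd : 0 < d) : ∃ (K : Type) (_ : Fintype K)
    (eff dual : K → Matrix (Fin d) (Fin d) ℂ), (∀ k, (eff k).PosSemidef) ∧ ∑ k, eff k = 1 ∧
      (∀ k, (dual k).PosSemidef) ∧ (∀ k, (dual k).trace.re ≤ 2 * d) ∧
      ∀ X : Matrix (Fin d) (Fin d) ℂ, ∑ k, (eff k * X).trace • dual k = X + X.trace • 1 := by
  have hphase : ∀ z : Fin d → Fin 3, (phaseProj z).PosSemidef := fun z =>
    posSemidef_vecMulVec_self_star _
  have hc : (0 : ℂ) ≤ 1 / 2 := by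
    rw [show (1 / 2 : ℂ) = ((1 / 2 : ℝ) : ℂ) by push_cast; rfl]
    exact_mod_cast (by norm_num : (0 : ℝ) ≤ 1 / 2)
  have hc' : (0 : ℂ) ≤ 1 / 2 * (3 ^ d)⁻¹ := by
    rw [show (1 / 2 * (3 ^ d)⁻¹ : ℂ) = ((1 / 2 * (3 ^ d)⁻¹ : ℝ) : ℂ) by push_cast; rfl]
    exact_mod_cast (by positivity : (0 : ℝ) ≤ 1 / 2 * (3 ^ d)⁻¹)
  have h3 : (3 : ℂ) ^ d ≠ 0 := by positivity
  have hd1 : (1 : ℝ) ≤ d := by exact_mod_cast hd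
  -- A fair coin chooses between the computational basis and the phase vectors. The basis outcomes
  -- supply exactly the diagonal that the phase vectors miss, and the factor 2 in the dual frame
  -- undoes the coin.
  refine ⟨Fin d ⊕ (Fin d → Fin 3), inferInstance,
    Sum.elim (fun a => (1 / 2 : ℂ) • single a a 1)
      (fun z => (1 / 2 * (3 ^ d)⁻¹ : ℂ) • phaseProj z),
    Sum.elim (fun a => (2 : ℂ) • single a a 1) (fun z => (2 : ℂ) • phaseProj z), ?_, ?_, ?_, ?_, ?_⟩
  · rintro (a | z)
    · exact (posSemidef_single a).smul hc
    · exact (hphase z).smul hc'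
  · rw [Fintype.sum_sum_type]
    simp only [Sum.elim_inl, Sum.elim_inr, ← Finset.smul_sum, sum_phaseProj, smul_smul]
    rw [mul_assoc, inv_mul_cancel₀ h3, mul_one, ← smul_add]
    have : ∑ a : Fin d, single a a (1 : ℂ) = 1 := by
      ext b c
      simp [Matrix.sum_apply, single_apply, one_apply, ite_and]
    rw [this, ← two_smul ℂ, smul_smul]
    norm_num
  · rintro (a | z)
    · exact (posSemidef_single a).smul zero_le_two
    · exact (hphase z).smul zero_le_two
  · rintro (a | z)
    · simp only [Sum.elim_inl, trace_smul, trace_single_eq_same]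
      simpa using hd1
    · simp only [Sum.elim_inr, trace_smul, trace_phaseProj]
      simp
  · intro X
    rw [Fintype.sum_sum_type]
    simp only [Sum.elim_inl, Sum.elim_inr, Matrix.smul_mul, trace_smul, smul_smul, smul_eq_mul]
    have e1 : ∑ a : Fin d, (1 / 2 * (single a a (1 : ℂ) * X).trace * 2) • single a a (1 : ℂ) =
        diagonal (fun a => X a a) := by
      ext b c
      simp only [trace_single_mul, Matrix.sum_apply, Matrix.smul_apply, single_apply, diagonal_apply,
        ite_and]
      by_cases h : b = c
      · subst h
        simp
        ring
      · simp [h]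
    have e2 : ∑ z : Fin d → Fin 3,
        (1 / 2 * (3 ^ d)⁻¹ * (phaseProj z * X).trace * 2 : ℂ) • phaseProj z =
        X + X.trace • 1 - diagonal (fun a => X a a) := by
      have : ∀ z : Fin d → Fin 3,
          (1 / 2 * (3 ^ d)⁻¹ * (phaseProj z * X).trace * 2 : ℂ) • phaseProj z =
          ((3 : ℂ) ^ d)⁻¹ • ((phaseProj z * X).trace • phaseProj z) := by
        intro z
        rw [smul_smul]
        congr 1
        ring
      rw [Finset.sum_congr rfl fun z _ => this z, ← Finset.smul_sum, sum_trace_phaseProj_smul,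
        smul_smul, inv_mul_cancel₀ h3, one_smul]
    rw [e1, e2]
    abel

end PhaseMeasurement

end QuditState

namespace QuditState

open Matrix
open scoped MatrixOrder ComplexOrder

/-! ### Effects of outcome assignments. -/

section Effects

variable {V K : Type*} {d : ℕ}

/-- The effects of an outcome assignment; `none` means that the site is not measured. -/
noncomputable def effects (eff : K → Matrix (Fin d) (Fin d) ℂ) (z : V → Option K) :
    V → Matrix (Fin d) (Fin d) ℂ := fun v => (z v).elim 1 eff

theorem posSemidef_effects {eff : K → Matrix (Fin d) (Fin d) ℂ} (heff : ∀ k, (eff k).PosSemidef)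
    (z : V → Option K) (v : V) : (effects eff z v).PosSemidef := by
  rw [effects]
  cases z v with
  | none => exact PosSemidef.one
  | some k => exact heff k

variable [DecidableEq V]

theorem effects_update (eff : K → Matrix (Fin d) (Fin d) ℂ) (z : V → Option K) (j : V)
    (k : K) : effects eff (Function.update z j (some k)) =
      Function.update (effects eff z) j (eff k) := by
  ext1 v
  by_cases hv : v = j
  · subst hv
    simp [effects]
  · simp [effects, hv]

theorem effects_update_one (eff : K → Matrix (Fin d) (Fin d) ℂ) {z : V → Option K} {j : V}
    (hz : z j = none) : Function.update (effects eff z) j 1 = effects eff z := by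
  rw [Function.update_eq_self_iff]
  simp [effects, hz]

end Effects

/-! ### Operators on two sites. -/

section PairTensor

variable {V : Type*} [DecidableEq V] {d : ℕ}

theorem prod_pair_subtype {M : Type*} [CommMonoid M] {i j : V} (hij : i ≠ j) {S : Finset V}
    (hS : S = {i, j}) (hi : i ∈ S) (hj : j ∈ S) (f : {v // v ∈ S} → M) :
    ∏ v, f v = f ⟨i, hi⟩ * f ⟨j, hj⟩ := by
  have : (Finset.univ : Finset {v // v ∈ S}) = {⟨i, hi⟩, ⟨j, hj⟩} := by
    ext ⟨v, hv⟩
    have := hv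
    rw [hS] at this
    simpa using this
  rw [this, Finset.prod_pair (by simpa using hij)]

/-- The operator `A ⊗ B` on the sites in `S = {i, j}`. -/
noncomputable def pairTensor (S : Finset V) (i : V) (A B : Matrix (Fin d) (Fin d) ℂ) :
    Op {v // v ∈ S} d :=
  tensor fun v => if v.1 = i then A else B

theorem pairTensor_apply {i j : V} (hij : i ≠ j) {S : Finset V} (hS : S = {i, j})
    (hi : i ∈ S) (hj : j ∈ S) (A B : Matrix (Fin d) (Fin d) ℂ) (x y : {v // v ∈ S} → Fin d) :
    pairTensor S i A B x y = A (x ⟨i, hi⟩) (y ⟨i, hi⟩) * B (x ⟨j, hj⟩) (y ⟨j, hj⟩) := by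
  rw [pairTensor, tensor, of_apply, prod_pair_subtype hij hS hi hj]
  simp [hij.symm]

theorem posSemidef_pairTensor (S : Finset V) (i : V) {A B : Matrix (Fin d) (Fin d) ℂ}
    (hA : A.PosSemidef) (hB : B.PosSemidef) : (pairTensor S i A B).PosSemidef := by
  refine posSemidef_tensor fun v => ?_
  split_ifs
  · exact hA
  · exact hB

theorem trace_pairTensor {i j : V} (hij : i ≠ j) {S : Finset V} (hS : S = {i, j})
    (A B : Matrix (Fin d) (Fin d) ℂ) : (pairTensor S i A B).trace = A.trace * B.trace := by
  have hi : i ∈ S := by simp [hS]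
  have hj : j ∈ S := by simp [hS]
  rw [pairTensor, trace_tensor, prod_pair_subtype hij hS hi hj]
  simp [hij.symm]

/-- Splitting each `A k` into positive and negative parts leaves tensor products of positive
operators, whose traces multiply. -/
theorem traceNorm_sum_pairTensor_le {i j : V} (hij : i ≠ j) {S : Finset V} (hS : S = {i, j})
    {κ : Type*} (s : Finset κ) {A B : κ → Matrix (Fin d) (Fin d) ℂ}
    (hA : ∀ k ∈ s, (A k).IsHermitian) (hB : ∀ k ∈ s, (B k).PosSemidef) {c : ℝ}
    (hc : ∀ k ∈ s, (B k).trace.re ≤ c) :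
    traceNorm (∑ k ∈ s, pairTensor S i (A k) (B k)) ≤ c * ∑ k ∈ s, traceNorm (A k) := by
  have hi : i ∈ S := by simp [hS]
  have hj : j ∈ S := by simp [hS]
  choose! P N hP hN hPN htr using fun k hk => exists_posSemidef_sub (hA k hk)
  have e : ∑ k ∈ s, pairTensor S i (A k) (B k) =
      ∑ k ∈ s, pairTensor S i (P k) (B k) - ∑ k ∈ s, pairTensor S i (N k) (B k) := by
    rw [← Finset.sum_sub_distrib]
    refine Finset.sum_congr rfl fun k hk => ?_
    ext x y
    rw [Matrix.sub_apply]
    simp only [pairTensor_apply hij hS hi hj]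
    conv_lhs => rw [hPN k hk]
    rw [Matrix.sub_apply]
    ring
  have hle : ∀ Q : κ → Matrix (Fin d) (Fin d) ℂ, (∀ k ∈ s, (Q k).PosSemidef) →
      (∑ k ∈ s, pairTensor S i (Q k) (B k)).trace.re ≤ ∑ k ∈ s, c * (Q k).trace.re := by
    intro Q hQ
    rw [trace_sum, Complex.re_sum]
    refine Finset.sum_le_sum fun k hk => ?_
    rw [trace_pairTensor hij hS, trace_eq_re (hQ k hk), Complex.re_ofReal_mul, mul_comm]
    exact mul_le_mul_of_nonneg_right (hc k hk) (trace_re_nonneg (hQ k hk))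
  rw [e]
  refine (traceNorm_sub_le (posSemidef_sum s fun k hk => posSemidef_pairTensor S i (hP k hk) (hB k hk))
    (posSemidef_sum s fun k hk => posSemidef_pairTensor S i (hN k hk) (hB k hk))).trans ?_
  refine (add_le_add (hle P hP) (hle N hN)).trans_eq ?_
  rw [← Finset.sum_add_distrib, Finset.mul_sum]
  exact Finset.sum_congr rfl fun k hk => by rw [htr k hk]; ring

end PairTensor

/-! ### Conditional and prepared states of single sites. -/

section CondSite

variable {V K : Type*} [Fintype V] [DecidableEq V] {d : ℕ}

variable (ρ : Op V d) (eff : K → Matrix (Fin d) (Fin d) ℂ)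

/-- The unnormalised state of the site `i` given the outcomes `z`. -/
noncomputable def condSite (z : V → Option K) (i : V) : Matrix (Fin d) (Fin d) ℂ :=
  siteOp ρ (effects eff z) i

/-- The probability of the outcomes `z`. -/
noncomputable def outcomeProb (z : V → Option K) : ℝ := (contraction ρ (effects eff z)).re

variable {ρ eff}

theorem posSemidef_condSite (hρ : ρ.PosSemidef) (heff : ∀ k, (eff k).PosSemidef)
    (z : V → Option K) (i : V) : (condSite ρ eff z i).PosSemidef :=
  posSemidef_siteOp hρ (posSemidef_effects heff z) i

theorem trace_condSite_eq {z : V → Option K} {i : V} (hz : z i = none) :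
    (condSite ρ eff z i).trace = contraction ρ (effects eff z) := by
  rw [condSite, trace_siteOp, effects_update_one eff hz]

theorem trace_condSite (hρ : ρ.PosSemidef) (heff : ∀ k, (eff k).PosSemidef) {z : V → Option K}
    {i : V} (hz : z i = none) : (condSite ρ eff z i).trace = (outcomeProb ρ eff z : ℂ) := by
  rw [trace_eq_re (posSemidef_condSite hρ heff z i), trace_condSite_eq hz, outcomeProb]

theorem outcomeProb_nonneg (hρ : ρ.PosSemidef) (heff : ∀ k, (eff k).PosSemidef)
    (z : V → Option K) : 0 ≤ outcomeProb ρ eff z :=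
  contraction_re_nonneg hρ (posSemidef_effects heff z)

theorem condSite_eq_sum [Fintype K] (heff : ∑ k, eff k = 1) {z : V → Option K} {i j : V} (hij : i ≠ j)
    (hz : z j = none) :
    condSite ρ eff z i = ∑ k, condSite ρ eff (Function.update z j (some k)) i := by
  simp only [condSite, effects_update]
  rw [← siteOp_update_sum ρ _ hij, heff, effects_update_one eff hz]

/-- The maximally mixed state. -/
noncomputable def maximallyMixed (d : ℕ) : Matrix (Fin d) (Fin d) ℂ := ((d : ℂ)⁻¹) • 1

theorem isState_maximallyMixed (hd : 0 < d) : IsState (maximallyMixed d) := by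
  constructor
  · refine PosSemidef.one.smul ?_
    rw [← Complex.ofReal_natCast, ← Complex.ofReal_inv]
    exact_mod_cast (by positivity : (0 : ℝ) ≤ (d : ℝ)⁻¹)
  · rw [maximallyMixed, trace_smul, trace_one]
    have : (d : ℂ) ≠ 0 := by exact_mod_cast hd.ne'
    simp [this]

variable (ρ eff) in
/-- The single-site state prepared at `v` upon the outcomes `z`. -/
noncomputable def preparedSite (z : V → Option K) (v : V) : Matrix (Fin d) (Fin d) ℂ :=
  -- The fallback only keeps every factor a state: measured sites are never compared with `ρ` beyond
  -- the trivial bound, and null outcomes have weight zero.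
  if z v = none ∧ outcomeProb ρ eff z ≠ 0 then
    ((outcomeProb ρ eff z : ℂ)⁻¹) • condSite ρ eff z v
  else maximallyMixed d

theorem isState_preparedSite (hd : 0 < d) (hρ : ρ.PosSemidef) (heff : ∀ k, (eff k).PosSemidef)
    (z : V → Option K) (v : V) : IsState (preparedSite ρ eff z v) := by
  rw [preparedSite]
  split_ifs with h
  · have h1 := trace_condSite hρ heff h.1
    have h2 := isState_normalize (posSemidef_condSite hρ heff z v)
      (by rw [h1, Complex.ofReal_re]; exact h.2)
    rwa [h1, Complex.ofReal_re] at h2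
  · exact isState_maximallyMixed hd

end CondSite

/-! ### Measuring a set of sites, and the measure-and-prepare state. -/

section Conditioning

variable {V : Type*} [Fintype V] [DecidableEq V] {d : ℕ} {K : Type*} [Fintype K] [DecidableEq K]

/-- The outcome assignments of a measurement of exactly the sites in `C`. -/
def outcomes (K : Type*) [Fintype K] [DecidableEq K] (C : Finset V) : Finset (V → Option K) :=
  Finset.univ.filter fun z => ∀ v, v ∈ C ↔ (z v).isSome

theorem mem_outcomes {C : Finset V} {z : V → Option K} :
    z ∈ outcomes K C ↔ ∀ v, v ∈ C ↔ (z v).isSome := by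
  simp [outcomes]

theorem outcomes_apply_eq_none {C : Finset V} {z : V → Option K} (hz : z ∈ outcomes K C) {v : V}
    (hv : v ∉ C) : z v = none := by
  have := (mem_outcomes.mp hz v).not.mp hv
  simpa using this

theorem outcomes_empty : outcomes K (∅ : Finset V) = {fun _ => none} := by
  ext z
  simp [mem_outcomes, funext_iff]

theorem sum_outcomes_insert {M : Type*} [AddCommMonoid M] {C : Finset V} {j : V} (hj : j ∉ C)
    (f : (V → Option K) → M) :
    ∑ z ∈ outcomes K (insert j C), f z =
      ∑ z ∈ outcomes K C, ∑ k, f (Function.update z j (some k)) := by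
  rw [← Finset.sum_product']
  symm
  refine Finset.sum_bij (fun zk _ => Function.update zk.1 j (some zk.2)) ?_ ?_ ?_ fun _ _ => rfl
  · rintro ⟨z, k⟩ hz
    rw [Finset.mem_product] at hz
    rw [mem_outcomes]
    intro v
    by_cases hv : v = j
    · subst hv
      simp
    · simpa [hv] using mem_outcomes.mp hz.1 v
  · rintro ⟨z, k⟩ hz ⟨w, l⟩ hw h
    rw [Finset.mem_product] at hz hw
    have h1 : k = l := by simpa using congrFun h j
    refine Prod.ext ?_ h1
    ext1 v
    by_cases hv : v = j
    · rw [hv]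
      exact (outcomes_apply_eq_none hz.1 hj).trans (outcomes_apply_eq_none hw.1 hj).symm
    · simpa [hv] using congrFun h v
  · intro w hw
    obtain ⟨k, hk⟩ := Option.isSome_iff_exists.mp
      ((mem_outcomes.mp hw j).mp (Finset.mem_insert_self j C))
    refine ⟨(Function.update w j none, k), ?_, ?_⟩
    · rw [Finset.mem_product, mem_outcomes]
      refine ⟨fun v => ?_, Finset.mem_univ _⟩
      by_cases hv : v = j
      · subst hv
        simp [hj]
      · have := mem_outcomes.mp hw v
        simpa [hv] using this
    · simp [← hk]

/-- Averaging over the outcomes of a measurement amounts to not measuring. -/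
theorem sum_outcomes_effects {M : Type*} [AddCommMonoid M] {eff : K → Matrix (Fin d) (Fin d) ℂ}
    (heff : ∑ k, eff k = 1) (F : (V → Matrix (Fin d) (Fin d) ℂ) → M) (C : Finset V)
    (hF : ∀ v ∈ C, ∀ T, F (Function.update T v (∑ k, eff k)) =
      ∑ k, F (Function.update T v (eff k))) :
    ∑ z ∈ outcomes K C, F (effects eff z) = F fun _ => 1 := by
  induction C using Finset.induction with
  | empty =>
    rw [outcomes_empty, Finset.sum_singleton]
    rfl
  | insert j C hj ih =>
    rw [sum_outcomes_insert hj, ← ih fun v hv => hF v (Finset.mem_insert_of_mem hv)]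
    refine Finset.sum_congr rfl fun z hz => ?_
    simp only [effects_update]
    rw [← hF j (Finset.mem_insert_self j C), heff,
      effects_update_one eff (outcomes_apply_eq_none hz hj)]

variable (ρ : Op V d) (eff : K → Matrix (Fin d) (Fin d) ℂ)

/-- The entropy of the site `i` conditioned on the outcomes of a measurement on `C`. -/
noncomputable def condEntropy (C : Finset V) (i : V) : ℝ :=
  ∑ z ∈ outcomes K C, weightedEntropy (condSite ρ eff z i)

variable {ρ eff}

theorem sum_outcomeProb (hρ : IsState ρ) (heff : ∑ k, eff k = 1) (C : Finset V) :
    ∑ z ∈ outcomes K C, outcomeProb ρ eff z = 1 := by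
  have h := sum_outcomes_effects heff (fun T => contraction ρ T) C
    fun v _ T => MultilinearMap.map_update_sum _ _ _ _ _
  rw [contraction_one, hρ.2] at h
  rw [← Complex.one_re, ← h, Complex.re_sum]
  rfl

theorem condEntropy_nonneg (hρ : ρ.PosSemidef) (heff : ∀ k, (eff k).PosSemidef) (C : Finset V)
    (i : V) : 0 ≤ condEntropy ρ eff C i :=
  Finset.sum_nonneg fun z _ => weightedEntropy_nonneg (posSemidef_condSite hρ heff z i)

theorem condEntropy_empty_le (hρ : IsState ρ) (heff : ∀ k, (eff k).PosSemidef) (i : V) :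
    condEntropy ρ eff ∅ i ≤ Real.log d := by
  rw [condEntropy, outcomes_empty, Finset.sum_singleton]
  have := weightedEntropy_le (R := condSite ρ eff (fun _ => none) i)
    ⟨posSemidef_condSite hρ.1 heff _ i, by
      rw [trace_condSite_eq rfl, ← hρ.2, ← contraction_one]; rfl⟩
  simpa using this

/-- The total deviation of the conditional states of `i` caused by a measurement of `j`. -/
noncomputable def deviation (ρ : Op V d) (eff : K → Matrix (Fin d) (Fin d) ℂ) (C : Finset V)
    (i j : V) : ℝ :=
  ∑ z ∈ outcomes K C, ∑ k, traceNorm (condSite ρ eff (Function.update z j (some k)) i -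
    ((outcomeProb ρ eff (Function.update z j (some k)) / outcomeProb ρ eff z : ℝ) : ℂ) •
      condSite ρ eff z i)

/-- Given `z`, the state of `i` is the mixture over the outcomes at `j`, so the Pinsker type bound
applies for each `z`; the `ε ^ 2` terms add up to one `ε ^ 2` because the probabilities sum to 1. -/
theorem deviation_le (hρ : IsState ρ) (heff : ∀ k, (eff k).PosSemidef) (heff1 : ∑ k, eff k = 1)
    {C : Finset V} {i j : V} (hi : i ∉ C) (hj : j ∉ C) (hij : i ≠ j) {ε : ℝ} (hε : 0 ≤ ε) :
    ε * deviation ρ eff C i j - ε ^ 2 ≤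
      condEntropy ρ eff C i - condEntropy ρ eff (insert j C) i := by
  have hp := sum_outcomeProb hρ heff1 C
  calc ε * deviation ρ eff C i j - ε ^ 2
      = ∑ z ∈ outcomes K C, (ε * ∑ k, traceNorm (condSite ρ eff (Function.update z j (some k)) i -
          ((outcomeProb ρ eff (Function.update z j (some k)) / outcomeProb ρ eff z : ℝ) : ℂ) •
            condSite ρ eff z i) - ε ^ 2 * outcomeProb ρ eff z) := by
        rw [Finset.sum_sub_distrib, ← Finset.mul_sum, ← Finset.mul_sum, hp, mul_one, deviation]
    _ ≤ ∑ z ∈ outcomes K C, (weightedEntropy (condSite ρ eff z i) -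
          ∑ k, weightedEntropy (condSite ρ eff (Function.update z j (some k)) i)) := by
        refine Finset.sum_le_sum fun z hz => ?_
        have hzi := outcomes_apply_eq_none hz hi
        have hzj := outcomes_apply_eq_none hz hj
        have h := sum_traceNorm_le_weightedEntropy_sub Finset.univ
          (fun k _ => posSemidef_condSite hρ.1 heff (Function.update z j (some k)) i)
          (condSite_eq_sum (ρ := ρ) heff1 hij hzj) hε
        have hk : ∀ k, (Function.update z j (some k)) i = none := fun k => by simp [hij, hzi]
        simpa only [trace_condSite hρ.1 heff hzi, trace_condSite hρ.1 heff (hk _),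
          Complex.ofReal_re] using h
    _ = _ := by
        rw [Finset.sum_sub_distrib, condEntropy, condEntropy, sum_outcomes_insert hj]

variable (ρ eff) in
/-- Measure the sites in `C` and prepare the product of the conditional single-site states. -/
noncomputable def measurePrepare (C : Finset V) : Op V d :=
  ∑ z ∈ outcomes K C, (outcomeProb ρ eff z : ℂ) • tensor (preparedSite ρ eff z)

theorem isState_measurePrepare (hd : 0 < d) (hρ : IsState ρ) (heff : ∀ k, (eff k).PosSemidef)
    (heff1 : ∑ k, eff k = 1) (C : Finset V) : IsState (measurePrepare ρ eff C) :=
  isState_convex _ (fun z _ => outcomeProb_nonneg hρ.1 heff z) (sum_outcomeProb hρ heff1 C)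
    fun z _ => isState_tensor (isState_preparedSite hd hρ.1 heff z)

theorem isGloballySeparable_measurePrepare (hd : 0 < d) (hρ : IsState ρ)
    (heff : ∀ k, (eff k).PosSemidef) (heff1 : ∑ k, eff k = 1) (C : Finset V) :
    IsGloballySeparable (measurePrepare ρ eff C) :=
  isGloballySeparable_sum _ (fun z _ => outcomeProb_nonneg hρ.1 heff z) (sum_outcomeProb hρ heff1 C)
    fun z _ => isState_preparedSite hd hρ.1 heff z

/-- Measuring `C` does not disturb the marginal of `{i, j}`, and the dual frame recovers the
operator at `j` from its outcome weights up to a multiple of the identity, which is subtracted. -/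
theorem marginal_eq_sum_pairTensor (heff1 : ∑ k, eff k = 1)
    {dual : K → Matrix (Fin d) (Fin d) ℂ}
    (hdual : ∀ X : Matrix (Fin d) (Fin d) ℂ,
      ∑ k, (eff k * X).trace • dual k = X + X.trace • 1)
    {C : Finset V} {i j : V} (hi : i ∉ C) (hj : j ∉ C) (hij : i ≠ j) {S : Finset V}
    (hS : S = {i, j}) :
    marginal S ρ = ∑ z ∈ outcomes K C,
      (∑ k, pairTensor S i (condSite ρ eff (Function.update z j (some k)) i) (dual k) -
        pairTensor S i (condSite ρ eff z i) 1) := by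
  have hiS : i ∈ S := by simp [hS]
  have hjS : j ∈ S := by simp [hS]
  ext x y
  set E := Matrix.single (y ⟨i, hiS⟩) (x ⟨i, hiS⟩) (1 : ℂ)
  set E' := Matrix.single (y ⟨j, hjS⟩) (x ⟨j, hjS⟩) (1 : ℂ)
  rw [marginal_pair_apply ρ hij hS hiS hjS, ← sum_outcomes_effects heff1
    (fun T => contraction ρ (Function.update (Function.update T i E) j E')) C]
  · rw [Matrix.sum_apply]
    refine Finset.sum_congr rfl fun z hz => ?_
    have hzj := outcomes_apply_eq_none hz hj
    rw [Matrix.sub_apply, Matrix.sum_apply]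
    simp only [pairTensor_apply hij hS hiS hjS]
    have hX : siteOp ρ (Function.update (effects eff z) i E) j (x ⟨j, hjS⟩) (y ⟨j, hjS⟩) =
        contraction ρ (Function.update (Function.update (effects eff z) i E) j E') := rfl
    rw [← hX]
    have h := hdual (siteOp ρ (Function.update (effects eff z) i E) j)
    have h' := congrFun (congrFun h (x ⟨j, hjS⟩)) (y ⟨j, hjS⟩)
    rw [Matrix.add_apply, Matrix.sum_apply] at h'
    rw [eq_sub_of_add_eq h'.symm, trace_siteOp, Function.update_comm hij,
      effects_update_one eff hzj]
    congr 1
    refine Finset.sum_congr rfl fun k _ => ?_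
    rw [Matrix.smul_apply, smul_eq_mul, ← contraction_update, Function.update_comm hij,
      ← effects_update]
    rfl
  · intro v hv T
    have hvi : v ≠ i := fun h => hi (h ▸ hv)
    have hvj : v ≠ j := fun h => hj (h ▸ hv)
    simp only [Function.update_comm hvi, Function.update_comm hvj]
    exact MultilinearMap.map_update_sum _ _ _ _ _

/-- The same dual expansion, now with the state of `i` independent of the outcome `k` at `j`. The
identity term has the same form as for `ρ`, so it cancels in the difference. -/
theorem marginal_measurePrepare (hd : 0 < d) (hρ : IsState ρ) (heff : ∀ k, (eff k).PosSemidef)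
    {dual : K → Matrix (Fin d) (Fin d) ℂ}
    (hdual : ∀ X : Matrix (Fin d) (Fin d) ℂ,
      ∑ k, (eff k * X).trace • dual k = X + X.trace • 1)
    {C : Finset V} {i j : V} (hi : i ∉ C) (hj : j ∉ C) (hij : i ≠ j) {S : Finset V}
    (hS : S = {i, j}) :
    marginal S (measurePrepare ρ eff C) = ∑ z ∈ outcomes K C,
      (∑ k, pairTensor S i
          (((outcomeProb ρ eff (Function.update z j (some k)) / outcomeProb ρ eff z : ℝ) : ℂ) •
            condSite ρ eff z i) (dual k) -
        pairTensor S i (condSite ρ eff z i) 1) := by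
  have hiS : i ∈ S := by simp [hS]
  have hjS : j ∈ S := by simp [hS]
  rw [measurePrepare, marginal_sum]
  refine Finset.sum_congr rfl fun z hz => ?_
  have hzi := outcomes_apply_eq_none hz hi
  have hzj := outcomes_apply_eq_none hz hj
  rw [marginal_smul, marginal_tensor S fun v _ => (isState_preparedSite hd hρ.1 heff z v).2]
  ext x y
  rw [Matrix.smul_apply, tensor, of_apply, prod_pair_subtype hij hS hiS hjS, Matrix.sub_apply,
    Matrix.sum_apply]
  simp only [pairTensor_apply hij hS hiS hjS, preparedSite, hzi, hzj, true_and, smul_eq_mul]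
  rcases eq_or_ne (outcomeProb ρ eff z) 0 with h0 | h0
  -- At a null outcome the quotient of probabilities is `0` by convention; this is harmless because
  -- the operator it multiplies vanishes.
  · have : condSite ρ eff z i = 0 := by
      rw [← (posSemidef_condSite hρ.1 heff z i).trace_eq_zero_iff, trace_condSite hρ.1 heff hzi, h0]
      simp
    simp [h0, this]
  · rw [if_pos h0, if_pos h0]
    have h0' : (outcomeProb ρ eff z : ℂ) ≠ 0 := by exact_mod_cast h0
    have h := congrFun (congrFun (hdual (condSite ρ eff z j)) (x ⟨j, hjS⟩)) (y ⟨j, hjS⟩)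
    rw [Matrix.add_apply, Matrix.sum_apply, trace_condSite hρ.1 heff hzj] at h
    have hp : ∀ k, (eff k * condSite ρ eff z j).trace =
        (outcomeProb ρ eff (Function.update z j (some k)) : ℂ) := by
      intro k
      rw [condSite, ← contraction_update, ← effects_update, ← trace_condSite hρ.1 heff (i := i)
        (by simpa [hij] using hzi), trace_condSite_eq (by simpa [hij] using hzi)]
    simp only [hp, Matrix.smul_apply, smul_eq_mul] at h ⊢
    have e : ∀ k, ((outcomeProb ρ eff (Function.update z j (some k)) / outcomeProb ρ eff z : ℝ) : ℂ) *
        condSite ρ eff z i (x ⟨i, hiS⟩) (y ⟨i, hiS⟩) * dual k (x ⟨j, hjS⟩) (y ⟨j, hjS⟩) =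
        (outcomeProb ρ eff z : ℂ)⁻¹ * condSite ρ eff z i (x ⟨i, hiS⟩) (y ⟨i, hiS⟩) *
          ((outcomeProb ρ eff (Function.update z j (some k)) : ℂ) *
            dual k (x ⟨j, hjS⟩) (y ⟨j, hjS⟩)) := by
      intro k
      push_cast
      ring
    simp only [e]
    rw [← Finset.mul_sum, h]
    field_simp
    ring

/-- Away from the measured sites, the two-site error is controlled by the deviation. -/
theorem traceNorm_marginal_sub_le (hd : 0 < d) (hρ : IsState ρ) (heff : ∀ k, (eff k).PosSemidef)
    (heff1 : ∑ k, eff k = 1) {dual : K → Matrix (Fin d) (Fin d) ℂ}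
    (hdualpos : ∀ k, (dual k).PosSemidef) (hdualtr : ∀ k, (dual k).trace.re ≤ 2 * d)
    (hdual : ∀ X : Matrix (Fin d) (Fin d) ℂ,
      ∑ k, (eff k * X).trace • dual k = X + X.trace • 1)
    {C : Finset V} {i j : V} (hi : i ∉ C) (hj : j ∉ C) (hij : i ≠ j) {S : Finset V}
    (hS : S = {i, j}) :
    traceNorm (marginal S ρ - marginal S (measurePrepare ρ eff C)) ≤
      2 * d * deviation ρ eff C i j := by
  have hiS : i ∈ S := by simp [hS]
  have hjS : j ∈ S := by simp [hS]
  have e : marginal S ρ - marginal S (measurePrepare ρ eff C) =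
      ∑ zk ∈ outcomes K C ×ˢ Finset.univ, pairTensor S i
        (condSite ρ eff (Function.update zk.1 j (some zk.2)) i -
          ((outcomeProb ρ eff (Function.update zk.1 j (some zk.2)) /
            outcomeProb ρ eff zk.1 : ℝ) : ℂ) • condSite ρ eff zk.1 i) (dual zk.2) := by
    rw [marginal_eq_sum_pairTensor heff1 hdual hi hj hij hS,
      marginal_measurePrepare hd hρ heff hdual hi hj hij hS, ← Finset.sum_sub_distrib,
      Finset.sum_product]
    refine Finset.sum_congr rfl fun z _ => ?_
    rw [sub_sub_sub_cancel_right, ← Finset.sum_sub_distrib]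
    refine Finset.sum_congr rfl fun k _ => ?_
    ext x y
    rw [Matrix.sub_apply]
    simp only [pairTensor_apply hij hS hiS hjS, Matrix.sub_apply]
    ring
  rw [e]
  refine (traceNorm_sum_pairTensor_le hij hS _ (fun zk _ => ?_) (fun zk _ => hdualpos zk.2)
    fun zk _ => hdualtr zk.2).trans_eq ?_
  · refine (posSemidef_condSite hρ.1 heff _ i).isHermitian.sub ?_
    rw [IsHermitian, conjTranspose_smul, (posSemidef_condSite hρ.1 heff zk.1 i).isHermitian.eq,
      Complex.star_def, Complex.conj_ofReal]
  · rw [Finset.sum_product, deviation]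

end Conditioning

end QuditState

namespace QuditState

open Matrix
open scoped MatrixOrder ComplexOrder

/-! ### Choice of the measured set and averaging over edges. -/

section Graph

variable {V : Type*} [Fintype V] [DecidableEq V]

theorem two_mul_sum_edgeFinset (G : SimpleGraph V) [DecidableRel G.Adj] (f : Sym2 V → ℝ) :
    2 * ∑ e ∈ G.edgeFinset, f e = ∑ i, ∑ j, if G.Adj i j then f s(i, j) else 0 := by
  have h1 : ∑ a : G.Dart, f a.edge = 2 * ∑ e ∈ G.edgeFinset, f e := by
    rw [← Finset.sum_fiberwise_of_maps_to (s := Finset.univ) (t := G.edgeFinset)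
      (g := fun a : G.Dart => a.edge) (fun a _ => by simp), Finset.mul_sum]
    refine Finset.sum_congr rfl fun e he => ?_
    rw [Finset.sum_congr rfl fun a ha => by rw [(Finset.mem_filter.mp ha).2], Finset.sum_const,
      G.dart_edge_fiber_card e (by simpa using he)]
    simp
  rw [← h1, ← Fintype.sum_prod_type', ← Finset.sum_filter]
  refine Finset.sum_bij (fun a _ => a.toProd) ?_ ?_ ?_ ?_
  · intro a _
    simp
  · intro a _ b _ h
    exact SimpleGraph.Dart.ext _ _ h
  · intro p hp
    exact ⟨⟨p, (Finset.mem_filter.mp hp).2⟩, Finset.mem_univ _, rfl⟩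
  · intro a _
    rfl

/-- Take a minimiser of `∑ i ∈ Cᶜ, H C i + l * |C|`. Comparison with `∅` bounds its size; comparison
with `insert j C` bounds the decrease, the dropped term `H C j` being nonnegative. -/
theorem exists_conditioning_set (H : Finset V → V → ℝ) (hH : ∀ C i, 0 ≤ H C i) {L l : ℝ}
    (hL : ∀ i, H ∅ i ≤ L) :
    ∃ C : Finset V, l * C.card ≤ Fintype.card V * L ∧
      ∀ j ∉ C, ∑ i ∈ (insert j C)ᶜ, (H C i - H (insert j C) i) ≤ l := by
  obtain ⟨C, -, hC⟩ := Finset.exists_min_image (Finset.univ : Finset (Finset V))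
    (fun C => ∑ i ∈ Cᶜ, H C i + l * C.card) Finset.univ_nonempty
  refine ⟨C, ?_, fun j hj => ?_⟩
  · have h := hC ∅ (Finset.mem_univ _)
    have h1 : 0 ≤ ∑ i ∈ Cᶜ, H C i := Finset.sum_nonneg fun i _ => hH C i
    have h2 : ∑ i, H ∅ i ≤ Fintype.card V * L :=
      (Finset.sum_le_sum fun i _ => hL i).trans_eq (by simp)
    simp only [Finset.compl_empty, Finset.card_empty, Nat.cast_zero, mul_zero, add_zero] at h
    linarith
  · have h := hC (insert j C) (Finset.mem_univ _)
    have h1 : ∑ i ∈ Cᶜ, H C i = H C j + ∑ i ∈ (insert j C)ᶜ, H C i := by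
      rw [Finset.compl_insert, Finset.add_sum_erase _ _ (Finset.mem_compl.mpr hj)]
    simp only [h1, Finset.card_insert_of_notMem hj, Nat.cast_add, Nat.cast_one] at h
    rw [Finset.sum_sub_distrib]
    linarith [hH C j]

/-- By regularity at most `|C| * D` edges meet `C`. As `g` is nonnegative, its sum over adjacent
pairs is at most its sum over all ordered pairs outside `C`, which is at most `|V| * l`; dividing by
the `|V| * D` ordered adjacent pairs gains the factor `1 / D`. -/
theorem edgeAverage_le (G : SimpleGraph V) [DecidableRel G.Adj] {D : ℕ}
    (hG : G.IsRegularOfDegree D) (C : Finset V) (f : Sym2 V → ℝ) (g : V → V → ℝ)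
    (hg : ∀ i j, i ∉ C → j ∉ C → i ≠ j → 0 ≤ g i j) {a b x l : ℝ} (ha : 0 ≤ a) (hx : 0 ≤ x)
    (hf : ∀ e ∈ G.edgeFinset, f e ≤ 2) (hb : 0 ≤ b)
    (hfg : ∀ i j, i ∉ C → j ∉ C → G.Adj i j → f s(i, j) ≤ a * g i j + b)
    (hsum : ∀ j ∉ C, ∑ i ∈ (insert j C)ᶜ, g i j ≤ l)
    (hl : 0 ≤ l) (hal : a * l ≤ D * b) (hC : (C.card : ℝ) ≤ Fintype.card V * x) :
    edgeAverage G f ≤ 4 * x + 2 * b := by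
  have hcount : ∀ i, ∑ j, (if G.Adj i j then (1 : ℝ) else 0) = D := by
    intro i
    rw [← hG i, ← Finset.sum_filter, Finset.sum_const, ← SimpleGraph.card_neighborFinset_eq_degree,
      SimpleGraph.neighborFinset_eq_filter]
    simp
  have hcount' : ∀ j, ∑ i, (if G.Adj i j then (1 : ℝ) else 0) = D := by
    intro j
    simpa only [G.adj_comm] using hcount j
  set c : V → ℝ := fun i => if i ∈ C then 1 else 0 with hcdef
  have hc0 : ∀ i, 0 ≤ c i := fun i => by simp only [hcdef]; split_ifs <;> norm_num
  have hcsum : ∑ i, c i = C.card := by simp [hcdef]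
  set g' : V → V → ℝ := fun i j => if i ∉ C ∧ j ∉ C ∧ i ≠ j then g i j else 0 with hgdef
  have hg'0 : ∀ i j, 0 ≤ g' i j := by
    intro i j
    simp only [hgdef]
    split_ifs with h
    · exact hg i j h.1 h.2.1 h.2.2
    · exact le_rfl
  have hterm : ∀ i j, (if G.Adj i j then f s(i, j) else 0) ≤
      (2 * c i * if G.Adj i j then 1 else 0) + (2 * c j * if G.Adj i j then 1 else 0) +
        a * g' i j + b * if G.Adj i j then 1 else 0 := by
    intro i j
    split_ifs with hij
    · by_cases hi : i ∈ C
      · have := hf s(i, j) (by simpa using hij)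
        have h1 : c i = 1 := by simp [hcdef, hi]
        rw [h1]
        linarith [hc0 j, mul_nonneg ha (hg'0 i j)]
      by_cases hj : j ∈ C
      · have := hf s(i, j) (by simpa using hij)
        have h1 : c j = 1 := by simp [hcdef, hj]
        rw [h1]
        linarith [hc0 i, mul_nonneg ha (hg'0 i j)]
      have h1 : g' i j = g i j := by simp [hgdef, hi, hj, hij.ne]
      rw [h1]
      linarith [hfg i j hi hj hij, hc0 i, hc0 j]
    · linarith [mul_nonneg ha (hg'0 i j)]
  have hgsum : ∑ i, ∑ j, g' i j ≤ Fintype.card V * l := by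
    rw [Finset.sum_comm]
    refine (Finset.sum_le_sum fun j _ => ?_).trans_eq
      (by rw [Finset.sum_const, nsmul_eq_mul, Finset.card_univ])
    by_cases hj : j ∈ C
    · simpa [hgdef, hj] using hl
    · refine le_trans (le_of_eq ?_) (hsum j hj)
      simp only [hgdef]
      rw [← Finset.sum_filter]
      refine Finset.sum_congr ?_ fun _ _ => rfl
      ext i
      simp only [Finset.mem_filter, Finset.mem_univ, true_and, Finset.mem_compl,
        Finset.mem_insert, not_or]
      tauto
  have htotal : 2 * ∑ e ∈ G.edgeFinset, f e ≤ 4 * C.card * D + a * (Fintype.card V * l) +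
      b * (Fintype.card V * D) := by
    rw [two_mul_sum_edgeFinset]
    refine (Finset.sum_le_sum fun i _ => Finset.sum_le_sum fun j _ => hterm i j).trans ?_
    simp only [Finset.sum_add_distrib]
    have e1 : ∑ i, ∑ j, (2 * c i * if G.Adj i j then (1 : ℝ) else 0) = 2 * C.card * D := by
      simp only [← Finset.mul_sum, hcount]
      rw [← Finset.sum_mul, ← Finset.mul_sum, hcsum]
    have e2 : ∑ i, ∑ j, (2 * c j * if G.Adj i j then (1 : ℝ) else 0) = 2 * C.card * D := by
      rw [Finset.sum_comm]
      simp only [← Finset.mul_sum, hcount']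
      rw [← Finset.sum_mul, ← Finset.mul_sum, hcsum]
    have e3 : ∑ i, ∑ j, (b * if G.Adj i j then (1 : ℝ) else 0) = b * (Fintype.card V * D) := by
      simp only [← Finset.mul_sum, hcount]
      simp
    have e4 : ∑ i, ∑ j, a * g' i j ≤ a * (Fintype.card V * l) := by
      simp only [← Finset.mul_sum]
      exact mul_le_mul_of_nonneg_left hgsum ha
    rw [e1, e2, e3]
    linarith
  have hcard : (Fintype.card V : ℝ) * D = 2 * G.edgeFinset.card := by
    have h := G.sum_degrees_eq_twice_card_edges
    simp only [hG.degree_eq, Finset.sum_const, Finset.card_univ, smul_eq_mul] at h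
    exact_mod_cast h
  have hn : (0 : ℝ) ≤ Fintype.card V := Nat.cast_nonneg _
  have hD : (0 : ℝ) ≤ D := Nat.cast_nonneg _
  rw [edgeAverage]
  refine div_le_of_le_mul₀ (Nat.cast_nonneg _) (by positivity) ?_
  have h1 : (C.card : ℝ) * D ≤ x * (2 * G.edgeFinset.card) := by
    rw [← hcard]
    nlinarith [mul_le_mul_of_nonneg_right hC hD]
  have h2 : a * (Fintype.card V * l) ≤ b * (2 * G.edgeFinset.card) := by
    rw [← hcard]
    nlinarith [mul_le_mul_of_nonneg_left hal hn]
  rw [hcard] at htotal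
  linarith

end Graph

/-! ### Choice of parameters and conclusion. -/

theorem exists_separable_approximation {V : Type*} [Fintype V] [DecidableEq V] (G : SimpleGraph V)
    [DecidableRel G.Adj] {D : ℕ} (hD : 0 < D) (hG : G.IsRegularOfDegree D) {d : ℕ} (hd : 2 ≤ d)
    {ρ : Op V d} (hρ : IsState ρ) {x : ℝ} (hx : 0 < x) (hx3 : x ^ 3 = d ^ 2 * Real.log d / D) :
    ∃ σ : Op V d, IsState σ ∧ IsGloballySeparable σ ∧
      edgeAverage G (fun e => traceNorm (marginal e.toFinset ρ - marginal e.toFinset σ)) ≤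
        8 * x := by
  classical
  have hd0 : 0 < d := by omega
  have hdr : (0 : ℝ) < d := by exact_mod_cast hd0
  have hDr : (0 : ℝ) < D := by exact_mod_cast hD
  have hlog : 0 < Real.log d := Real.log_pos (by exact_mod_cast hd)
  obtain ⟨K, _, eff, dual, heff, heff1, hdualpos, hdualtr, hdual⟩ := exists_measurement hd0
  obtain ⟨C, hCcard, hC⟩ := exists_conditioning_set (condEntropy ρ eff)
    (condEntropy_nonneg hρ.1 heff) (l := Real.log d / x) (condEntropy_empty_le hρ heff)
  have hσ := isState_measurePrepare hd0 hρ heff heff1 C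
  refine ⟨measurePrepare ρ eff C, hσ, isGloballySeparable_measurePrepare hd0 hρ heff heff1 C, ?_⟩
  have hfin : ∀ i j : V, (s(i, j) : Sym2 V).toFinset = {i, j} := fun i j => by
    ext v
    simp
  have key := edgeAverage_le G hG C
    (fun e => traceNorm (marginal e.toFinset ρ - marginal e.toFinset (measurePrepare ρ eff C)))
    (fun i j => condEntropy ρ eff C i - condEntropy ρ eff (insert j C) i)
    -- At `ε = 0` the deviation bound says that conditioning does not increase entropy.
    (fun i j hi hj hij => by
      simpa using deviation_le hρ heff heff1 hi hj hij le_rfl)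
    -- With these values `a * l = D * b` holds exactly by the choice of `x`, and `4 * x + 2 * b = 8
    -- * x`.
    (a := 2 * d ^ 2 / x) (b := 2 * x) (x := x) (l := Real.log d / x) (by positivity) hx.le
    (fun e _ => traceNorm_sub_le_two (isState_marginal _ hρ) (isState_marginal _ hσ))
    (by positivity) ?_ hC (by positivity) ?_ ?_
  · linarith
  · intro i j hi hj hij
    refine (traceNorm_marginal_sub_le hd0 hρ heff heff1 hdualpos hdualtr hdual hi hj hij.ne
      (hfin i j)).trans ?_
    -- This `ε` makes `a * ε = 2 * d`, the dual frame factor, and `a * ε ^ 2 = 2 * x = b`.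
    have h := deviation_le hρ heff heff1 hi hj hij.ne (ε := x / d) (by positivity)
    have h' := mul_le_mul_of_nonneg_left h (by positivity : 0 ≤ 2 * (d : ℝ) ^ 2 / x)
    have e : 2 * (d : ℝ) ^ 2 / x * (x / d * deviation ρ eff C i j - (x / d) ^ 2) =
        2 * d * deviation ρ eff C i j - 2 * x := by
      field_simp
    rw [e] at h'
    linarith
  · have e : 2 * (d : ℝ) ^ 2 / x * (Real.log d / x) = 2 * x ^ 3 * D / x ^ 2 := by
      rw [hx3]
      field_simp
    rw [e]
    apply le_of_eq
    field_simp
  · have h := mul_le_mul_of_nonneg_left hCcard (by positivity : 0 ≤ x / Real.log d)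
    have e1 : x / Real.log d * (Real.log d / x * C.card) = C.card := by
      field_simp
    have e2 : x / Real.log d * (Fintype.card V * Real.log d) = Fintype.card V * x := by
      field_simp
    rwa [e1, e2] at h

/-- With a one-dimensional total space the only state is a product state. -/
theorem isGloballySeparable_of_subsingleton {V : Type*} [Fintype V] [DecidableEq V] {d : ℕ}
    [Subsingleton (V → Fin d)] {ρ : Op V d} (hρ : IsState ρ) : IsGloballySeparable ρ := by
  obtain ⟨x⟩ := hρ.nonempty
  have huniv : (Finset.univ : Finset (V → Fin d)) = {x} :=
    Finset.eq_singleton_iff_unique_mem.mpr ⟨Finset.mem_univ x, fun y _ => Subsingleton.elim y x⟩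
  have htrace : ρ x x = 1 := by
    have h := hρ.2
    rwa [Matrix.trace, huniv, Finset.sum_singleton] at h
  refine ⟨1, fun _ => 1, fun _ v => single (x v) (x v) 1, fun _ => zero_le_one, by simp,
    fun _ v => ⟨?_, by simp⟩, ?_⟩
  · exact posSemidef_single (x v)
  · ext y z
    obtain rfl := Subsingleton.elim x y
    obtain rfl := Subsingleton.elim x z
    simp [htrace, tensor]

end QuditState

theorem theorem1 {V : Type*} [Fintype V] [DecidableEq V] (G : SimpleGraph V)
    [DecidableRel G.Adj] (D : ℕ) (hD : 0 < D) (hG : G.IsRegularOfDegree D)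
    (d : ℕ) (ρ : QuditState.Op V d) (hρ : QuditState.IsState ρ) :
    ∃ σ : QuditState.Op V d, QuditState.IsState σ ∧ QuditState.IsGloballySeparable σ ∧
      QuditState.edgeAverage G (fun e => QuditState.traceNorm
          (QuditState.marginal e.toFinset ρ - QuditState.marginal e.toFinset σ)) ≤
        12 * ((d : ℝ) ^ 2 * Real.log (d : ℝ) / (D : ℝ)) ^ (1 / 3 : ℝ) := by
  have hDr : (0 : ℝ) < D := by exact_mod_cast hD
  rcases Nat.lt_or_ge d 2 with hd | hd
  -- For `d ≤ 1` the logarithm vanishes and so does the bound, so `σ` must have the same edge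
  -- marginals as `ρ`; `ρ` itself is a product state.
  · have : Subsingleton (Fin d) := Fin.subsingleton_iff_le_one.mpr (by omega)
    refine ⟨ρ, hρ, QuditState.isGloballySeparable_of_subsingleton hρ, ?_⟩
    simp only [sub_self, QuditState.traceNorm_zero, QuditState.edgeAverage, Finset.sum_const_zero,
      zero_div]
    positivity
  · have hlog : 0 < Real.log (d : ℝ) := Real.log_pos (by exact_mod_cast hd)
    have hdr : (0 : ℝ) < d := by positivity
    have hb : 0 < (d : ℝ) ^ 2 * Real.log (d : ℝ) / (D : ℝ) := by positivity
    have hx := Real.rpow_pos_of_pos hb (1 / 3)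
    obtain ⟨σ, h1, h2, h3⟩ := QuditState.exists_separable_approximation G hD hG hd hρ hx (by
      rw [← Real.rpow_natCast, ← Real.rpow_mul hb.le]
      norm_num)
    exact ⟨σ, h1, h2, h3.trans (by linarith)⟩
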